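/- \textbf{Definitions.} All graphs are finite, simple and undirected. A synchronous game $\mathcal G=(I,O,\lambda)$ has finite question and answer sets $I,O$ and a rule function $\lambda:O\times O\times I\times I\to\{0,1\}$ with $\lambda(a,b,x,x)=0$ for $a\ne b$. Its game $*$-algebra $\mathcal A(\mathcal G)$ is the universal unital complex $*$-algebra generated by self-adjoint idempotents $e_{a,x}$ ($a\in O$, $x\in I$) with $\sum_{a}e_{a,x}=1$ for all $x$, and $e_{a,x}e_{b,y}=0$ whenever $\lambda(a,b,x,y)=0$. A family of real numbers $p(a,b|x,y)$ wins $\mathcal G$ if $p(a,b|x,y)=0$ whenever $\lambda(a,b,x,y)=0$. The game has a winning qc-strategy if some winning $p$ has the form $p(a,b|x,y)=\tau(E_{a,x}E_{b,y})$ with $\tau$ a tracial state on a unital $C^*$-algebra $A$ and projections $E_{a,x}\in A$ with $\sum_aE_{a,x}=1$ for all $x$. It has a winning loc-, q- or qa-strategy if in addition $A$ can be taken abelian, finite-dimensional, or equal to a tracial ultrapower $\mathcal R^{\mathcal U}$ of the hyperfinite $II_1$ factor (with its trace), respectively. It has a winning $C^*$-strategy (respectively hered-strategy) if there is a unital $*$-homomorphism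 from $\mathcal A(\mathcal G)$ to a non-zero unital $C^*$-algebra (respectively to a non-zero hereditary unital complex $*$-algebra, i.e. one in which $\sum_ix_i^*x_i=0$ implies that all $x_i=0$). In the game $\mathrm{Hom}(G,H)$ one has $I=V(G)$, $O=V(H)$, and $\lambda(a,b,x,y)=0$ exactly when $x=y$ and $a\neq b$, or $x\sim y$ in $G$ and $a\not\sim b$ in $H$. For $t\in\{loc,q,qa,qc,C^*,hered\}$, $\chi_t(G)$ is the least $c$ such that $\mathrm{Hom}(G,K_c)$ has a winning $t$-strategy. The locally commuting chromatic number $\chi_{lc}(G)$ is the least $c$ for which the following algebra is non-zero: the universal unital complex $*$-algebra generated by self-adjoint idempotents $e_{a,x}$ ($1\le a\le c$, $x\in V(G)$) with $\sum_ae_{a,x}=1$; $e_{a,x}e_{b,x}=0$ for $a\ne b$; and, for $x\sim y$, $e_{a,x}e_{a,y}=0$ and $e_{a,x}e_{b,y}=e_{b,y}e_{a,x}$ for all $a,b$. \textbf{The graph.} The following graph $G$ is obtained from the game $\mathrm{Hom}(K_5,K_4)$; let $x,y$ range over $\{1,\dots,5\}$ and $\alpha$ over $\{1,2\}$. Start with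 a triangle $A,B,C$. For each $(\alpha,x)$ add a $3\times3$ rook's graph with vertices $v(i,j,\alpha,x)$, $1\le i,j\le3$ (two vertices are adjacent when exactly one of $i,j$ agrees), and two adjacent vertices $t(1,\alpha,x)\sim t(2,\alpha,x)$. Identify $v(1,2,\alpha,x)=B$ and $v(3,2,1,x)=v(1,1,2,x)$, and add the edges $A\sim v(3,3,\alpha,x)$, $C\sim v(2,1,\alpha,x)$, $v(1,1,\alpha,x)\sim t(1,\alpha,x)$, $v(1,3,\alpha,x)\sim t(2,\alpha,x)$, $A\sim t(1,\alpha,x)$ and $A\sim t(2,\alpha,x)$. Put $\widehat v(1,x)=v(1,1,1,x)$, $\widehat v(2,x)=v(2,1,1,x)$, $\widehat v(3,x)=v(2,1,2,x)$ and $\widehat v(4,x)=v(2,2,2,x)$. For all $1\le a\le4$ and $x<y$, add a $3\times 3$ rook's graph with vertices $q(i,j)=q(i,j,a,x,y)$, identify $q(1,1)=\widehat v(a,x)$, $q(2,2)=\widehat v(a,y)$, and $q(1,2)=B$ if $a\in\{1,4\}$, $q(1,2)=C$ if $a\in\{2,3\}$, and add the edge $A\sim q(3,3)$. \textbf{Corollary.}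 This graph $G$ satisfies $$\chi_{lc}(G)=3<\chi_{hered}(G).$$ Moreover $\chi_{lc}(G)<\chi_t(G)$, and in particular $\chi_{lc}\neq\chi_t$, for every $t\in\{loc,q,qa,qc,C^*,hered\}$. -/

import Mathlib

noncomputable section

namespace SyncGames

/-! ## Complex `*`-algebras given by generators and relations -/

/-- The free unital complex algebra on `X`; its involution (below) is conjugate linear
and fixes every generator. -/
def FreeStarAlgebra (X : Type) : Type := FreeAlgebra ℂ X

instance (X : Type) : Ring (FreeStarAlgebra X) := inferInstanceAs (Ring (FreeAlgebra ℂ X))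

instance (X : Type) : Algebra ℂ (FreeStarAlgebra X) :=
  inferInstanceAs (Algebra ℂ (FreeAlgebra ℂ X))

/-- The generators of the free `*`-algebra. -/
def gen {X : Type} (x : X) : FreeStarAlgebra X := FreeAlgebra.ι ℂ x

theorem FreeStarAlgebra.induction {X : Type} {P : FreeStarAlgebra X → Prop}
    (h1 : ∀ c : ℂ, P (algebraMap ℂ _ c)) (h2 : ∀ x, P (gen x))
    (h3 : ∀ a b, P a → P b → P (a * b)) (h4 : ∀ a b, P a → P b → P (a + b))
    (a : FreeStarAlgebra X) : P a :=
  FreeAlgebra.induction (motive := P) ℂ X h1 h2 h3 h4 a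

/-- The opposite of the free algebra, with scalars acting through complex conjugation. -/
def ConjOp (X : Type) : Type := (FreeStarAlgebra X)ᵐᵒᵖ

instance (X : Type) : Ring (ConjOp X) := inferInstanceAs (Ring (FreeStarAlgebra X)ᵐᵒᵖ)

instance (X : Type) : Algebra ℂ (ConjOp X) :=
  ((algebraMap ℂ (FreeStarAlgebra X)ᵐᵒᵖ).comp (starRingEnd ℂ)).toAlgebra'
    (fun c x => Algebra.commutes (starRingEnd ℂ c) x)

/-- The algebra homomorphism to the conjugate opposite that fixes the generators. -/
def conjOpHom (X : Type) : FreeAlgebra ℂ X →ₐ[ℂ] ConjOp X :=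
  FreeAlgebra.lift ℂ (fun x => (MulOpposite.op (gen x) : (FreeStarAlgebra X)ᵐᵒᵖ))

/-- The conjugate linear antihomomorphism of the free algebra that fixes the generators. -/
def starHom (X : Type) : FreeStarAlgebra X →+* (FreeStarAlgebra X)ᵐᵒᵖ :=
  (conjOpHom X).toRingHom

theorem starHom_gen {X : Type} (x : X) : starHom X (gen x) = MulOpposite.op (gen x) :=
  FreeAlgebra.lift_ι_apply (A := ConjOp X)
    (fun x => (MulOpposite.op (gen x) : (FreeStarAlgebra X)ᵐᵒᵖ)) x

theorem starHom_algebraMap {X : Type} (c : ℂ) :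
    starHom X (algebraMap ℂ _ c) = MulOpposite.op (algebraMap ℂ _ (starRingEnd ℂ c)) :=
  AlgHom.commutes (conjOpHom X) c

instance (X : Type) : StarRing (FreeStarAlgebra X) where
  star a := (starHom X a).unop
  star_involutive a := by
    induction a using FreeStarAlgebra.induction with
    | h1 c => simp [starHom_algebraMap]
    | h2 x => simp [starHom_gen]
    | h3 a b ha hb => simp [ha, hb]
    | h4 a b ha hb => simp [ha, hb]
  star_mul a b := by simp
  star_add a b := by simp

theorem star_gen {X : Type} (x : X) : star (gen x) = gen x :=
  congrArg MulOpposite.unop (starHom_gen x)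

theorem star_free_algebraMap {X : Type} (c : ℂ) :
    star (algebraMap ℂ (FreeStarAlgebra X) c) = algebraMap ℂ _ (star c) :=
  congrArg MulOpposite.unop (starHom_algebraMap c)

instance (X : Type) : StarModule ℂ (FreeStarAlgebra X) where
  star_smul c a := by
    rw [Algebra.smul_def, star_mul, star_free_algebraMap, Algebra.smul_def, Algebra.commutes]

/-- The involution on the quotient of a `*`-ring by a `*`-compatible ring congruence. -/
@[reducible] def starRingQuotient {R : Type} [Ring R] [StarRing R] (c : RingCon R)
    (hc : ∀ a b, c a b → c (star a) (star b)) : StarRing c.Quotient where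
  star := Quotient.map' star hc
  star_involutive := by
    rintro ⟨a⟩
    exact congrArg (fun z : R => (z : c.Quotient)) (star_star a)
  star_mul := by
    rintro ⟨a⟩ ⟨b⟩
    exact congrArg (fun z : R => (z : c.Quotient)) (star_mul a b)
  star_add := by
    rintro ⟨a⟩ ⟨b⟩
    exact congrArg (fun z : R => (z : c.Quotient)) (star_add a b)

/-- The ring congruence of the smallest `*`-closed two-sided ideal that contains `S`. -/
def starCon {X : Type} (S : Set (FreeStarAlgebra X)) : RingCon (FreeStarAlgebra X) :=
  ringConGen (fun a b => b = 0 ∧ (a ∈ S ∨ star a ∈ S))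

theorem starCon_star {X : Type} (S : Set (FreeStarAlgebra X)) (a b : FreeStarAlgebra X)
    (h : starCon S a b) : starCon S (star a) (star b) := by
  refine ringConGen_star ?_ h
  rintro a b ⟨rfl, h | h⟩
  · exact ⟨star_zero _, Or.inr (by rwa [star_star])⟩
  · exact ⟨star_zero _, Or.inl h⟩

/-- The universal unital complex `*`-algebra with self-adjoint generators indexed by `X`,
subject to the relations `r = 0` for `r ∈ S`. -/
def Presented {X : Type} (S : Set (FreeStarAlgebra X)) : Type := (starCon S).Quotient

instance {X : Type} (S : Set (FreeStarAlgebra X)) : Ring (Presented S) :=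
  inferInstanceAs (Ring (starCon S).Quotient)

instance {X : Type} (S : Set (FreeStarAlgebra X)) : Algebra ℂ (Presented S) :=
  inferInstanceAs (Algebra ℂ (starCon S).Quotient)

instance {X : Type} (S : Set (FreeStarAlgebra X)) : StarRing (Presented S) :=
  starRingQuotient (starCon S) (starCon_star S)

instance {X : Type} (S : Set (FreeStarAlgebra X)) : StarModule ℂ (Presented S) where
  star_smul := by
    rintro c ⟨a⟩
    exact congrArg (fun z : FreeStarAlgebra X => (z : (starCon S).Quotient)) (star_smul c a)

/-! ## Tracial states and the hyperfinite II₁ factor -/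

/-- A tracial state on a unital complex `*`-algebra. -/
structure TracialState (A : Type) [Ring A] [StarRing A] [Algebra ℂ A] where
  /-- the underlying linear functional -/
  toFun : A →ₗ[ℂ] ℂ
  map_one : toFun 1 = 1
  re_nonneg : ∀ x, 0 ≤ (toFun (star x * x)).re
  im_eq_zero : ∀ x, (toFun (star x * x)).im = 0
  trace : ∀ x y, toFun (x * y) = toFun (y * x)

/-- The Hilbert space `ℓ²(Γ)`. -/
abbrev ell2 (Γ : Type) : Type := lp (fun _ : Γ => ℂ) 2

/-- The right translation operator `(ρ_g f)(h) = f(hg)` on `ℓ²(Γ)`. -/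
def rightTranslation {Γ : Type} [Group Γ] (g : Γ) : ell2 Γ →L[ℂ] ell2 Γ :=
  LinearIsometry.toContinuousLinearMap
    { toFun := fun f => ⟨fun h => f (h * g), by
        have h2 : 0 < (2 : ENNReal).toReal := by norm_num
        have := (memℓp_gen_iff h2).1 f.2
        exact (memℓp_gen_iff h2).2 ((Equiv.mulRight g).summable_iff.2 this)⟩
      map_add' := fun _ _ => rfl
      map_smul' := fun _ _ => rfl
      norm_map' := fun f => by
        have h2 : 0 < (2 : ENNReal).toReal := by norm_num
        rw [lp.norm_eq_tsum_rpow h2, lp.norm_eq_tsum_rpow h2]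
        congr 1
        exact (Equiv.mulRight g).tsum_eq (fun h => ‖f h‖ ^ (2 : ENNReal).toReal) }

theorem rightTranslation_apply {Γ : Type} [Group Γ] (g h : Γ) (f : ell2 Γ) :
    rightTranslation g f h = f (h * g) := rfl

/-- The group von Neumann algebra of a discrete group: the commutant of the right
translations on `ℓ²(Γ)`. -/
def groupVN (Γ : Type) [Group Γ] : StarSubalgebra ℂ (ell2 Γ →L[ℂ] ell2 Γ) :=
  StarSubalgebra.centralizer ℂ (Set.range rightTranslation)

/-- The vector `δ_1 ∈ ℓ²(Γ)`. -/
def delta (Γ : Type) [Group Γ] : ell2 Γ :=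
  open Classical in lp.single 2 (1 : Γ) (1 : ℂ)

theorem inner_delta_left {Γ : Type} [Group Γ] (f : ell2 Γ) : inner ℂ (delta Γ) f = f 1 := by
  classical
  unfold delta
  rw [lp.inner_single_left]
  simp

theorem inner_rightTranslation {Γ : Type} [Group Γ] (g : Γ) (f k : ell2 Γ) :
    inner ℂ (rightTranslation g f) k = inner ℂ f (rightTranslation g⁻¹ k) := by
  rw [lp.inner_eq_tsum, lp.inner_eq_tsum, ← (Equiv.mulRight g⁻¹).tsum_eq]
  refine tsum_congr fun h => ?_
  simp [rightTranslation_apply]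

theorem norm_delta (Γ : Type) [Group Γ] : ‖delta Γ‖ = 1 := by
  classical
  unfold delta
  rw [lp.norm_single (by norm_num)]
  simp

theorem star_apply_delta {Γ : Type} [Group Γ] (x : groupVN Γ) (g : Γ) :
    (star x : groupVN Γ).1 (delta Γ) g = star (x.1 (delta Γ) g⁻¹) := by
  have key : ∀ (y : groupVN Γ) (g : Γ),
      y.1 (delta Γ) g = (y.1 (rightTranslation g (delta Γ))) 1 := by
    intro y g
    have h := ((StarSubalgebra.mem_centralizer_iff ℂ).1 y.2 _ ⟨g, rfl⟩).1
    have h' := congrArg (fun T : ell2 Γ →L[ℂ] ell2 Γ => T (delta Γ) 1) h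
    simpa [rightTranslation_apply] using h'
  rw [key, ← inner_delta_left]
  have h1 : (star x : groupVN Γ).1 = ContinuousLinearMap.adjoint x.1 := rfl
  rw [h1, ContinuousLinearMap.adjoint_inner_right, ← inner_conj_symm, inner_rightTranslation,
    inner_delta_left, rightTranslation_apply, one_mul]
  rfl

/-- The linear functional `x ↦ ⟨δ_1, x δ_1⟩` on a group von Neumann algebra. -/
def groupTrace (Γ : Type) [Group Γ] : groupVN Γ →ₗ[ℂ] ℂ where
  toFun x := inner ℂ (delta Γ) (x.1 (delta Γ))
  map_add' x y := by simp
  map_smul' c x := by simp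

theorem groupTrace_star_mul {Γ : Type} [Group Γ] (x y : groupVN Γ) :
    groupTrace Γ (star x * y) = inner ℂ (x.1 (delta Γ)) (y.1 (delta Γ)) :=
  ContinuousLinearMap.adjoint_inner_right x.1 (delta Γ) (y.1 (delta Γ))

theorem groupTrace_mul_comm {Γ : Type} [Group Γ] (x y : groupVN Γ) :
    groupTrace Γ (x * y) = groupTrace Γ (y * x) := by
  have h : ∀ x y : groupVN Γ, groupTrace Γ (star x * y) = groupTrace Γ (y * star x) := by
    intro x y
    have h2 := groupTrace_star_mul (star y) (star x)
    rw [star_star] at h2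
    rw [groupTrace_star_mul, h2, lp.inner_eq_tsum, lp.inner_eq_tsum,
      ← (Equiv.inv Γ).tsum_eq]
    refine tsum_congr fun g => ?_
    rw [star_apply_delta, star_apply_delta]
    simp [mul_comm]
  simpa using h (star x) y

/-- The `2`-norm `‖x‖₂ = τ(x^* x)^{1/2} = ‖x δ_1‖` of the trace. -/
def norm2 {Γ : Type} [Group Γ] (x : groupVN Γ) : ℝ := ‖x.1 (delta Γ)‖

theorem groupTrace_star_mul_self {Γ : Type} [Group Γ] (x : groupVN Γ) :
    groupTrace Γ (star x * x) = ((norm2 x ^ 2 : ℝ) : ℂ) := by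
  rw [groupTrace_star_mul, inner_self_eq_norm_sq_to_K]
  simp [norm2]

theorem norm2_nonneg {Γ : Type} [Group Γ] (x : groupVN Γ) : 0 ≤ norm2 x := norm_nonneg _

theorem norm2_star {Γ : Type} [Group Γ] (x : groupVN Γ) : norm2 (star x) = norm2 x := by
  have h1 := groupTrace_star_mul_self x
  have h2 := groupTrace_star_mul_self (star x)
  rw [star_star, groupTrace_mul_comm, h1] at h2
  have h3 : norm2 x ^ 2 = norm2 (star x) ^ 2 := by exact_mod_cast h2
  exact ((sq_eq_sq₀ (norm2_nonneg _) (norm2_nonneg _)).1 h3).symm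

theorem norm2_add_le {Γ : Type} [Group Γ] (x y : groupVN Γ) :
    norm2 (x + y) ≤ norm2 x + norm2 y :=
  norm_add_le (x.1 (delta Γ)) (y.1 (delta Γ))

theorem norm2_mul_le {Γ : Type} [Group Γ] (x y : groupVN Γ) :
    norm2 (x * y) ≤ ‖x‖ * norm2 y :=
  x.1.le_opNorm (y.1 (delta Γ))

theorem norm2_mul_le' {Γ : Type} [Group Γ] (x y : groupVN Γ) :
    norm2 (x * y) ≤ norm2 x * ‖y‖ := by
  rw [← norm2_star, star_mul, mul_comm]
  have h := norm2_mul_le (star y) (star x)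
  have h2 : ‖star y‖ = ‖y‖ := norm_star y.1
  rwa [norm2_star x, h2] at h

theorem norm_groupTrace_le {Γ : Type} [Group Γ] (x : groupVN Γ) :
    ‖groupTrace Γ x‖ ≤ norm2 x := by
  have h := norm_inner_le_norm (𝕜 := ℂ) (delta Γ) (x.1 (delta Γ))
  rwa [norm_delta, one_mul] at h

theorem norm2_le {Γ : Type} [Group Γ] (x : groupVN Γ) : norm2 x ≤ ‖x‖ := by
  have h := x.1.le_opNorm (delta Γ)
  rwa [norm_delta, mul_one] at h

/-- The norm-bounded sequences in a group von Neumann algebra. -/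
def boundedSeq (Γ : Type) [Group Γ] : StarSubalgebra ℂ (ℕ → groupVN Γ) where
  carrier := {f | ∃ C : ℝ, ∀ n, ‖f n‖ ≤ C}
  mul_mem' := by
    rintro f g ⟨C, hC⟩ ⟨D, hD⟩
    exact ⟨C * D, fun n => (norm_mul_le _ _).trans
      (mul_le_mul (hC n) (hD n) (norm_nonneg _) ((norm_nonneg _).trans (hC n)))⟩
  add_mem' := by
    rintro f g ⟨C, hC⟩ ⟨D, hD⟩
    exact ⟨C + D, fun n => (norm_add_le _ _).trans (add_le_add (hC n) (hD n))⟩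
  algebraMap_mem' := fun c => ⟨‖algebraMap ℂ (groupVN Γ) c‖, fun _ => le_rfl⟩
  star_mem' := by
    rintro f ⟨C, hC⟩
    exact ⟨C, fun n => (norm_star (f n).1).le.trans (hC n)⟩

open Filter Topology in
/-- Two bounded sequences are identified when `‖f n - g n‖₂ → 0` along a fixed free
ultrafilter on `ℕ`. -/
def ultraCon (Γ : Type) [Group Γ] : RingCon (boundedSeq Γ) where
  r f g := Tendsto (fun n => norm2 (f.1 n - g.1 n)) (hyperfilter ℕ) (𝓝 0)
  iseqv := by
    refine ⟨fun f => ?_, fun {f g} h => ?_, fun {f g k} h1 h2 => ?_⟩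
    · simp [norm2]
    · refine h.congr fun n => ?_
      simp only [norm2]
      rw [← norm_neg]
      congr 1
      simp
    · refine squeeze_zero (fun n => norm2_nonneg _) (fun n => ?_)
        (by simpa using h1.add h2)
      have := norm2_add_le (f.1 n - g.1 n) (g.1 n - k.1 n)
      simpa using this
  add' := by
    intro f g h k h1 h2
    refine squeeze_zero (fun n => norm2_nonneg _) (fun n => ?_) (by simpa using h1.add h2)
    have := norm2_add_le (f.1 n - g.1 n) (h.1 n - k.1 n)
    refine le_trans (le_of_eq ?_) this
    congr 1
    change f.1 n + h.1 n - (g.1 n + k.1 n) = _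
    abel
  mul' := by
    intro f g h k h1 h2
    obtain ⟨C, hC⟩ := g.2
    obtain ⟨D, hD⟩ := h.2
    refine squeeze_zero (fun n => norm2_nonneg _) (fun n => ?_)
      (by simpa using (h1.mul_const D).add (h2.const_mul C))
    have e : (f * h).1 n - (g * k).1 n
        = (f.1 n - g.1 n) * h.1 n + g.1 n * (h.1 n - k.1 n) := by
      change f.1 n * h.1 n - g.1 n * k.1 n = _
      noncomm_ring
    rw [e]
    refine (norm2_add_le _ _).trans (add_le_add ?_ ?_)
    · exact (norm2_mul_le' _ _).trans
        (mul_le_mul_of_nonneg_left (hD n) (norm2_nonneg _))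
    · exact (norm2_mul_le _ _).trans
        (mul_le_mul_of_nonneg_right (hC n) (norm2_nonneg _))

theorem ultraCon_star {Γ : Type} [Group Γ] (f g : boundedSeq Γ) (h : ultraCon Γ f g) :
    ultraCon Γ (star f) (star g) := by
  refine Filter.Tendsto.congr (fun n => ?_) h
  rw [← norm2_star, star_sub]
  rfl

/-- The tracial ultrapower of a group von Neumann algebra. -/
def Ultrapower (Γ : Type) [Group Γ] : Type := (ultraCon Γ).Quotient

instance (Γ : Type) [Group Γ] : Ring (Ultrapower Γ) :=
  inferInstanceAs (Ring (ultraCon Γ).Quotient)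

instance (Γ : Type) [Group Γ] : Algebra ℂ (Ultrapower Γ) :=
  inferInstanceAs (Algebra ℂ (ultraCon Γ).Quotient)

instance (Γ : Type) [Group Γ] : StarRing (Ultrapower Γ) :=
  starRingQuotient (ultraCon Γ) ultraCon_star

instance (Γ : Type) [Group Γ] : StarModule ℂ (Ultrapower Γ) where
  star_smul := by
    rintro c ⟨f⟩
    exact congrArg (fun z : boundedSeq Γ => (z : (ultraCon Γ).Quotient)) (star_smul c f)

open Filter Topology in
/-- The trace `lim τ(f n)`, along the ultrafilter, of a bounded sequence. -/
def ultraTraceSeq {Γ : Type} [Group Γ] (f : boundedSeq Γ) : ℂ :=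
  limUnder (hyperfilter ℕ : Filter ℕ) (fun n => groupTrace Γ (f.1 n))

open Filter Topology in
theorem tendsto_ultraTraceSeq {Γ : Type} [Group Γ] (f : boundedSeq Γ) :
    Tendsto (fun n => groupTrace Γ (f.1 n)) (hyperfilter ℕ) (𝓝 (ultraTraceSeq f)) := by
  obtain ⟨C, hC⟩ := f.2
  have hb : ∀ n, groupTrace Γ (f.1 n) ∈ Metric.closedBall (0 : ℂ) C := fun n => by
    rw [mem_closedBall_zero_iff]
    exact (norm_groupTrace_le _).trans ((norm2_le _).trans (hC n))
  obtain ⟨z, -, hz⟩ := (isCompact_closedBall (0 : ℂ) C).ultrafilter_le_nhds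
    ((hyperfilter ℕ).map fun n => groupTrace Γ (f.1 n))
    (le_principal_iff.2 (Filter.mem_map.2 (Filter.univ_mem' hb)))
  exact tendsto_nhds_limUnder ⟨z, hz⟩

theorem ultraTraceSeq_congr {Γ : Type} [Group Γ] (f g : boundedSeq Γ) (h : ultraCon Γ f g) :
    ultraTraceSeq f = ultraTraceSeq g := by
  have h1 := (tendsto_ultraTraceSeq f).sub (tendsto_ultraTraceSeq g)
  have h2 : Filter.Tendsto (fun n => groupTrace Γ (f.1 n) - groupTrace Γ (g.1 n))
      (Filter.hyperfilter ℕ) (nhds 0) := by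
    refine squeeze_zero_norm (fun n => ?_) h
    rw [← map_sub]
    exact norm_groupTrace_le _
  exact sub_eq_zero.1 (tendsto_nhds_unique h1 h2)

/-- The canonical trace of the tracial ultrapower of a group von Neumann algebra. -/
def ultraTrace (Γ : Type) [Group Γ] : TracialState (Ultrapower Γ) where
  toFun :=
    { toFun := Quotient.lift ultraTraceSeq ultraTraceSeq_congr
      map_add' := by
        rintro ⟨f⟩ ⟨g⟩
        refine tendsto_nhds_unique (tendsto_ultraTraceSeq (f + g)) ?_
        refine ((tendsto_ultraTraceSeq f).add (tendsto_ultraTraceSeq g)).congr fun n => ?_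
        exact (map_add (groupTrace Γ) _ _).symm
      map_smul' := by
        rintro c ⟨f⟩
        refine tendsto_nhds_unique (tendsto_ultraTraceSeq (c • f)) ?_
        refine ((tendsto_ultraTraceSeq f).const_mul c).congr fun n => ?_
        exact (map_smul (groupTrace Γ) c _).symm }
  map_one := by
    refine tendsto_nhds_unique (tendsto_ultraTraceSeq 1) ?_
    refine tendsto_const_nhds.congr fun n => ?_
    change (1 : ℂ) = inner ℂ (delta Γ) (delta Γ)
    rw [inner_self_eq_norm_sq_to_K, norm_delta]
    simp
  re_nonneg := by
    rintro ⟨f⟩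
    refine ge_of_tendsto' ((Complex.continuous_re.tendsto _).comp
      (tendsto_ultraTraceSeq (star f * f))) fun n => ?_
    change 0 ≤ (groupTrace Γ (star (f.1 n) * f.1 n)).re
    rw [groupTrace_star_mul_self, Complex.ofReal_re]
    positivity
  im_eq_zero := by
    rintro ⟨f⟩
    refine tendsto_nhds_unique ((Complex.continuous_im.tendsto _).comp
      (tendsto_ultraTraceSeq (star f * f))) (tendsto_const_nhds.congr fun n => ?_)
    change 0 = (groupTrace Γ (star (f.1 n) * f.1 n)).im
    rw [groupTrace_star_mul_self, Complex.ofReal_im]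
  trace := by
    rintro ⟨f⟩ ⟨g⟩
    refine tendsto_nhds_unique (tendsto_ultraTraceSeq (f * g)) ?_
    refine (tendsto_ultraTraceSeq (g * f)).congr fun n => ?_
    exact groupTrace_mul_comm (g.1 n) (f.1 n)

/-- The group `S_∞` of finitely supported permutations of `ℕ`. -/
def finitaryPerm : Subgroup (Equiv.Perm ℕ) where
  carrier := {s | {n | s n ≠ n}.Finite}
  one_mem' := by simp
  mul_mem' := by
    intro s t hs ht
    refine (hs.union ht).subset fun n hn => ?_
    by_contra h
    simp only [Set.mem_union, Set.mem_ofPred_eq, not_or, not_not] at h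
    exact hn (by simp [h.1, h.2])
  inv_mem' := by
    intro s hs
    refine hs.subset fun n hn h => hn ?_
    rw [Equiv.Perm.inv_eq_iff_eq]
    exact h.symm

/-- The tracial ultrapower `R^U` of the hyperfinite II₁ factor `R`, realised as the group
von Neumann algebra of the group of finitely supported permutations of `ℕ`. -/
abbrev HyperfiniteUltrapower : Type := Ultrapower finitaryPerm

/-! ## Synchronous games and their winning strategies -/

/-- A synchronous non-local game with question set `I` and answer set `O`. Here `rule a b x y`
means that the rule function takes the value `1` at `(a, b, x, y)`. -/
structure SyncGame (I O : Type) where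
  /-- the allowed tuples -/
  rule : O → O → I → I → Prop
  sync : ∀ (x : I) (a b : O), a ≠ b → ¬ rule a b x x

/-- The graph homomorphism game `Hom(G, H)`. -/
def homGame {V W : Type} (G : SimpleGraph V) (H : SimpleGraph W) : SyncGame V W where
  rule a b x y := (x = y → a = b) ∧ (G.Adj x y → H.Adj a b)
  sync _ _ _ hab h := hab (h.1 rfl)

/-- The defining relations of the game `*`-algebra, besides self-adjointness of the
generators `e_{a,x}`. -/
def gameRelations {I O : Type} [Fintype O] (𝒢 : SyncGame I O) :
    Set (FreeStarAlgebra (O × I)) :=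
  {r | (∃ a x, r = gen (a, x) * gen (a, x) - gen (a, x)) ∨
    (∃ x, r = ∑ a, gen (a, x) - 1) ∨
    (∃ a b x y, ¬ 𝒢.rule a b x y ∧ r = gen (a, x) * gen (b, y))}

/-- The game `*`-algebra. -/
abbrev GameAlgebra {I O : Type} [Fintype O] (𝒢 : SyncGame I O) : Type :=
  Presented (gameRelations 𝒢)

/-- A family `(E_{a,x})` of projections with `∑_a E_{a,x} = 1` for every `x`. -/
structure IsPVMFamily {I O A : Type} [Fintype O] [Ring A] [StarRing A] (E : O → I → A) :
    Prop where
  proj : ∀ a x, IsStarProjection (E a x)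
  sum_eq_one : ∀ x, ∑ a, E a x = 1

/-- The correlations `p(a,b|x,y) = τ(E_{a,x} E_{b,y})` in a `*`-algebra with a tracial state. -/
def tracialCorrelations (I O : Type) [Fintype O] {A : Type} [Ring A] [StarRing A]
    [Algebra ℂ A] (τ : TracialState A) : Set (O → O → I → I → ℝ) :=
  {p | ∃ E : O → I → A, IsPVMFamily E ∧
    ∀ a b x y, ((p a b x y : ℝ) : ℂ) = τ.toFun (E a x * E b y)}

/-- The synchronous correlations of the local model. -/
def Cloc (I O : Type) [Fintype O] : Set (O → O → I → I → ℝ) :=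
  {p | ∃ (A : Type) (_ : CommCStarAlgebra A) (τ : TracialState A), p ∈ tracialCorrelations I O τ}

/-- The synchronous correlations of the quantum model. -/
def Cq (I O : Type) [Fintype O] : Set (O → O → I → I → ℝ) :=
  {p | ∃ (A : Type) (_ : CStarAlgebra A) (_ : FiniteDimensional ℂ A) (τ : TracialState A),
    p ∈ tracialCorrelations I O τ}

/-- The synchronous correlations of the quantum approximate model. -/
def Cqa (I O : Type) [Fintype O] : Set (O → O → I → I → ℝ) :=
  tracialCorrelations I O (ultraTrace finitaryPerm : TracialState HyperfiniteUltrapower)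

/-- The synchronous correlations of the quantum commuting model. -/
def Cqc (I O : Type) [Fintype O] : Set (O → O → I → I → ℝ) :=
  {p | ∃ (A : Type) (_ : CStarAlgebra A) (τ : TracialState A), p ∈ tracialCorrelations I O τ}

/-- A correlation wins the game when it gives probability zero to every forbidden tuple. -/
def Wins {I O : Type} (𝒢 : SyncGame I O) (p : O → O → I → I → ℝ) : Prop :=
  ∀ a b x y, ¬ 𝒢.rule a b x y → p a b x y = 0

/-- Hereditary `*`-algebras: a sum of elements `x^* x` vanishes only if every term's `x` is
zero. -/
def IsHereditary (A : Type) [Ring A] [StarRing A] : Prop :=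
  ∀ (m : ℕ) (x : Fin m → A), ∑ i, star (x i) * x i = 0 → ∀ i, x i = 0

/-- The models of strategies. -/
inductive Model
  | loc | q | qa | qc | cstar | hered | alg

/-- The existence of a winning strategy in a given model. -/
def HasWinningStrategy {I O : Type} [Fintype O] (𝒢 : SyncGame I O) : Model → Prop
  | .loc => ∃ p ∈ Cloc I O, Wins 𝒢 p
  | .q => ∃ p ∈ Cq I O, Wins 𝒢 p
  | .qa => ∃ p ∈ Cqa I O, Wins 𝒢 p
  | .qc => ∃ p ∈ Cqc I O, Wins 𝒢 p
  | .cstar => ∃ (B : Type) (_ : CStarAlgebra B), Nontrivial B ∧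
      Nonempty (GameAlgebra 𝒢 →⋆ₐ[ℂ] B)
  | .hered => ∃ (B : Type) (_ : Ring B) (_ : StarRing B) (_ : Algebra ℂ B) (_ : StarModule ℂ B),
      Nontrivial B ∧ IsHereditary B ∧ Nonempty (GameAlgebra 𝒢 →⋆ₐ[ℂ] B)
  | .alg => Nontrivial (GameAlgebra 𝒢)

/-- The chromatic number `χ_t(G)`: the least `c` such that `Hom(G, K_c)` has a winning
`t`-strategy. -/
def chromaticNumber {V : Type} [Finite V] (t : Model) (G : SimpleGraph V) : ℕ :=
  sInf {c : ℕ | HasWinningStrategy (homGame G (⊤ : SimpleGraph (Fin c))) t}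

/-! ## The locally commuting chromatic number -/

/-- The defining relations of the algebra of locally commuting `c`-colorings of `G`, besides
self-adjointness of the generators `e_{a,x}`. -/
def lcRelations {V : Type} (G : SimpleGraph V) (c : ℕ) : Set (FreeStarAlgebra (Fin c × V)) :=
  {r | (∃ a x, r = gen (a, x) * gen (a, x) - gen (a, x)) ∨
    (∃ x, r = ∑ a, gen (a, x) - 1) ∨
    (∃ a b x, a ≠ b ∧ r = gen (a, x) * gen (b, x)) ∨
    (∃ a x y, G.Adj x y ∧ r = gen (a, x) * gen (a, y)) ∨
    (∃ a b x y, G.Adj x y ∧ r = gen (a, x) * gen (b, y) - gen (b, y) * gen (a, x))}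

/-- The locally commuting chromatic number `χ_lc(G)`: the least `c` such that the universal
`*`-algebra of locally commuting `c`-colorings is non-zero. -/
def lcChromaticNumber {V : Type} [Finite V] (G : SimpleGraph V) : ℕ :=
  sInf {c : ℕ | Nontrivial (Presented (lcRelations G c))}

/-! ## The graph of a synchronous game

Questions are `0, …, n - 1` and answers are `0, …, k - 1` with `k = m + 3`. -/

/-- The game with the asymmetric rule function: for `x < y` it merges the rules for `(x, y)` and
`(y, x)`, and for `x > y` it allows everything. -/
def SyncGame.asymmetric {n : ℕ} {O : Type} (𝒢 : SyncGame (Fin n) O) : SyncGame (Fin n) O where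
  rule a b x y := (x = y → a = b) ∧ (x < y → 𝒢.rule a b x y ∧ 𝒢.rule b a y x)
  sync _ _ _ hab h := hab (h.1 rfl)

section Reduction

variable {n m : ℕ}

/-- The first and the last answer. -/
def IsExtreme (a : Fin (m + 3)) : Prop := a = 0 ∨ a = Fin.last (m + 2)

/-- Forbidden tuples with `x ≠ y` and both answers extreme. -/
def SetE (𝒢 : SyncGame (Fin n) (Fin (m + 3))) (a b : Fin (m + 3)) (x y : Fin n) : Prop :=
  ¬ 𝒢.rule a b x y ∧ x ≠ y ∧ IsExtreme a ∧ IsExtreme b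

/-- Forbidden tuples with `x ≠ y` and no extreme answer. -/
def SetF (𝒢 : SyncGame (Fin n) (Fin (m + 3))) (a b : Fin (m + 3)) (x y : Fin n) : Prop :=
  ¬ 𝒢.rule a b x y ∧ x ≠ y ∧ ¬ IsExtreme a ∧ ¬ IsExtreme b

/-- The vertices before identification: a triangle `A, B, C`, a `3 × 3` rook's graph
`v · · α x` and two prism vertices `t · α x` for each `α < k - 2` and each question `x`, and a
`3 × 3` rook's graph `q · · a b x y` for each tuple in `SetE` or `SetF`. -/
inductive RawVertex (𝒢 : SyncGame (Fin n) (Fin (m + 3))) : Type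
  | A | B | C
  | v (i j : Fin 3) (α : Fin (m + 1)) (x : Fin n)
  | t (s : Fin 2) (α : Fin (m + 1)) (x : Fin n)
  | q (i j : Fin 3) (a b : Fin (m + 3)) (x y : Fin n) (h : SetE 𝒢 a b x y ∨ SetF 𝒢 a b x y)

/-- The vertex that carries answer `a` to question `x`. -/
def RawVertex.hat (𝒢 : SyncGame (Fin n) (Fin (m + 3))) (a : Fin (m + 3)) (x : Fin n) :
    RawVertex 𝒢 :=
  if a = 0 then .v 0 0 0 x
  else if h : a = Fin.last (m + 2) then .v 1 1 (Fin.last m) x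
  else .v 1 0 ⟨a.1 - 1, by have h1 := a.2; have h2 := mt Fin.ext h; simp at h2; omega⟩ x

/-- The identifications of vertices. -/
inductive RawVertex.Ident (𝒢 : SyncGame (Fin n) (Fin (m + 3))) :
    RawVertex 𝒢 → RawVertex 𝒢 → Prop
  | v12 (α x) : Ident 𝒢 (.v 0 1 α x) .B
  | chain (α : Fin m) (x) : Ident 𝒢 (.v 2 1 α.castSucc x) (.v 0 0 α.succ x)
  | q11 (a b x y h) : Ident 𝒢 (.q 0 0 a b x y h) (.hat 𝒢 a x)
  | q22 (a b x y h) : Ident 𝒢 (.q 1 1 a b x y h) (.hat 𝒢 b y)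
  | q12E (a b x y) (h : SetE 𝒢 a b x y) : Ident 𝒢 (.q 0 1 a b x y (.inl h)) .B
  | q12F (a b x y) (h : SetF 𝒢 a b x y) : Ident 𝒢 (.q 0 1 a b x y (.inr h)) .C

/-- Adjacency in the `3 × 3` rook's graph: exactly one coordinate agrees. -/
def RookAdj (i j i' j' : Fin 3) : Prop := (i = i' ∧ j ≠ j') ∨ (i ≠ i' ∧ j = j')

/-- The edges (in one direction), before identification. -/
inductive RawVertex.Edge (𝒢 : SyncGame (Fin n) (Fin (m + 3))) :
    RawVertex 𝒢 → RawVertex 𝒢 → Prop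
  | AB : Edge 𝒢 .A .B
  | BC : Edge 𝒢 .B .C
  | AC : Edge 𝒢 .A .C
  | rookV (i j i' j' α x) (h : RookAdj i j i' j') : Edge 𝒢 (.v i j α x) (.v i' j' α x)
  | Av33 (α x) : Edge 𝒢 .A (.v 2 2 α x)
  | Cv21 (α x) : Edge 𝒢 .C (.v 1 0 α x)
  | prism1 (α x) : Edge 𝒢 (.v 0 0 α x) (.t 0 α x)
  | prism2 (α x) : Edge 𝒢 (.v 0 2 α x) (.t 1 α x)
  | prismA (s α x) : Edge 𝒢 .A (.t s α x)
  | prismT (α x) : Edge 𝒢 (.t 0 α x) (.t 1 α x)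
  | direct (a b x y) (h : ¬ 𝒢.rule a b x y) (hxy : x ≠ y) (hE : ¬ SetE 𝒢 a b x y)
      (hF : ¬ SetF 𝒢 a b x y) : Edge 𝒢 (.hat 𝒢 a x) (.hat 𝒢 b y)
  | rookQ (i j i' j' a b x y h) (hr : RookAdj i j i' j') :
      Edge 𝒢 (.q i j a b x y h) (.q i' j' a b x y h)
  | Aq33 (a b x y h) : Edge 𝒢 .A (.q 2 2 a b x y h)

/-- The vertices of the graph of the game. -/
abbrev ReductionVertex (𝒢 : SyncGame (Fin n) (Fin (m + 3))) : Type :=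
  Quot (RawVertex.Ident 𝒢)

/-- The graph of the game, whose `3`-colorings encode strategies for the game. -/
def reductionGraph (𝒢 : SyncGame (Fin n) (Fin (m + 3))) : SimpleGraph (ReductionVertex 𝒢) :=
  SimpleGraph.fromRel fun u w =>
    ∃ a b, Quot.mk _ a = u ∧ Quot.mk _ b = w ∧ RawVertex.Edge 𝒢 a b

instance (𝒢 : SyncGame (Fin n) (Fin (m + 3))) : Finite (RawVertex 𝒢) := by
  let f : (Fin 3 ⊕ (Fin 3 × Fin 3 × Fin (m + 1) × Fin n)) ⊕ ((Fin 2 × Fin (m + 1) × Fin n) ⊕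
      (Fin 3 × Fin 3 × {z : Fin (m + 3) × Fin (m + 3) × Fin n × Fin n //
        SetE 𝒢 z.1 z.2.1 z.2.2.1 z.2.2.2 ∨ SetF 𝒢 z.1 z.2.1 z.2.2.1 z.2.2.2})) →
      RawVertex 𝒢 := fun z => match z with
    | .inl (.inl 0) => .A
    | .inl (.inl 1) => .B
    | .inl (.inl 2) => .C
    | .inl (.inr (i, j, α, x)) => .v i j α x
    | .inr (.inl (s, α, x)) => .t s α x
    | .inr (.inr (i, j, z)) => .q i j z.1.1 z.1.2.1 z.1.2.2.1 z.1.2.2.2 z.2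
  refine Finite.of_surjective f ?_
  rintro (_ | _ | _ | ⟨i, j, α, x⟩ | ⟨s, α, x⟩ | ⟨i, j, a, b, x, y, h⟩)
  · exact ⟨.inl (.inl 0), rfl⟩
  · exact ⟨.inl (.inl 1), rfl⟩
  · exact ⟨.inl (.inl 2), rfl⟩
  · exact ⟨.inl (.inr (i, j, α, x)), rfl⟩
  · exact ⟨.inr (.inl (s, α, x)), rfl⟩
  · exact ⟨.inr (.inr (i, j, ⟨(a, b, x, y), h⟩)), rfl⟩

end Reduction

end SyncGames

end

noncomputable section

namespace SyncGames

/-! ## Idempotents -/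

section Idempotents

variable {R : Type*} [Ring R] [Algebra ℂ R]

/-! The graph is built so that its 3-colorings by idempotents encode families `P a x` of
four-outcome measurements, `x` in a five-element set, with `P a x * P a y = 0` for `x ≠ y`: an
algebraic 4-coloring of `K₅`. The corollary holds because such families exist over some nonzero
complex algebra, but over no nonzero hereditary `*`-algebra.

Existence (`exists_exclusive_measurements`): take four idempotents in the endomorphisms of a vector
space on which a group acts by translations, such that every nontrivial translation is compressed to
zero by each of them. Their conjugates by translations form the family. Spreading the outcomes over
classical colorings of the gadgets (`exists_isColoring_reductionGraph`) gives a 3-coloring of the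
graph. With three colors, idempotents at adjacent vertices commute automatically
(`IsColoring.commute_of_adj`), so the locally commuting algebra with three colors is nonzero; the
triangle rules out fewer colors (`IsColoring.three_le`).

Obstruction (`IsColoring.false_of_isHereditary`): given a 3-coloring, let `decode e a x` be the
observable that `A` has the same color as the vertex of answer `a` to `x`. All idempotents in a
rook's graph or a prism commute, by a purely algebraic argument on Latin cubes (`latin_commute`), so
each gadget can be analysed through its deterministic colorings (`eq_of_forall_assignment`). The
gadgets yield `∑ a, decode e a x = 1` and `decode e a x * decode e a y = 0`. For self-adjoint
colorings, the four elements `∑ x, decode e a x` are then projections with total `5`; the squares of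
`1` and of their complements add up to `1 + 4 - 5 = 0`, which a nonzero hereditary algebra forbids.

Every model in question produces a coloring by projections of a nonzero hereditary algebra: directly
for homomorphisms into hereditary or C*-algebras, and after division by the null ideal when there is
a trace (`hasHereditaryColoring_of_trace`). -/

theorem eq_zero_of_add_self {x : R} (h : x + x = 0) : x = 0 := by
  have h2 : (2 : ℂ) • x = 0 := by rw [two_smul, h]
  exact (smul_eq_zero_iff_right (by norm_num : (2 : ℂ) ≠ 0)).1 h2

theorem eq_zero_of_add_self_add_self {x : R} (h : x + x + x = 0) : x = 0 := by
  have h2 : (3 : ℂ) • x = 0 := by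
    rw [show (3 : ℂ) = 1 + 1 + 1 by norm_num, add_smul, add_smul, one_smul, h]
  exact (smul_eq_zero_iff_right (by norm_num : (3 : ℂ) ≠ 0)).1 h2

/-- Two idempotents whose sum is idempotent are orthogonal. -/
theorem mul_eq_zero_of_idempotent_add {p q : R} (hp : p * p = p) (hq : q * q = q)
    (h : (p + q) * (p + q) = p + q) : p * q = 0 := by
  have h1 : p * q + q * p = 0 := by
    rw [mul_add, add_mul, add_mul, hp, hq] at h
    have : p * q + q * p = (p + q * p + (p * q + q)) - (p + q) := by abel
    rw [this, h, sub_self]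
  -- Multiplying `pq + qp = 0` by `p` on the left and on the right gives `pq = -pqp = qp`, hence
  -- `2pq = 0`.
  have h2 : p * q + p * q * p = 0 := by
    have := congrArg (p * ·) h1
    simpa only [mul_add, ← mul_assoc, hp, mul_zero] using this
  have h3 : p * q * p + q * p = 0 := by
    have := congrArg (· * p) h1
    simpa only [add_mul, mul_assoc, hp, zero_mul] using this
  have h4 : p * q = q * p := by
    rw [eq_neg_of_add_eq_zero_left h2, eq_neg_of_add_eq_zero_right h3]
  exact eq_zero_of_add_self (by rw [← h4] at h1; exact h1)

theorem mul_eq_zero_of_add_add_eq_one {p q r : R} (hp : p * p = p) (hq : q * q = q)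
    (hr : r * r = r) (h : p + q + r = 1) : p * q = 0 := by
  refine mul_eq_zero_of_idempotent_add hp hq ?_
  have : p + q = 1 - r := by rw [← h]; abel
  rw [this, mul_sub, sub_mul, sub_mul, hr]
  simp

/-- Three idempotents with sum zero vanish. -/
theorem eq_zero_of_add_add_eq_zero {p q r : R} (hp : p * p = p) (hq : q * q = q)
    (hr : r * r = r) (h : p + q + r = 0) : p = 0 := by
  have hr' : r = -(p + q) := eq_neg_of_add_eq_zero_right h
  have h1 : p * q + q * p + (p + q) + (p + q) = 0 := by
    rw [hr', neg_mul_neg, mul_add, add_mul, add_mul, hp, hq] at hr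
    have : p * q + q * p + (p + q) + (p + q)
        = (p + q * p + (p * q + q)) - (-(p + q)) := by abel
    rw [this, hr, sub_self]
  -- multiply by `p` on both sides
  have h2 : p * q + p * q * p + (p + p * q) + (p + p * q) = 0 := by
    have := congrArg (p * ·) h1
    simpa only [mul_add, ← mul_assoc, hp, mul_zero] using this
  have h3 : p * q * p + p * q * p + (p + p * q * p) + (p + p * q * p) = 0 := by
    have := congrArg (· * p) h2
    simpa only [add_mul, mul_assoc, hp, zero_mul] using this
  have h4 : p * q * p + p * q * p + p = 0 := by
    refine eq_zero_of_add_self ?_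
    rw [← h3]; abel
  -- Twice `h2` minus `h4` is three times `2pq + p`; right multiplication by `q` then leaves `3pq =
  -- 0`, and so `p = 0`.
  have h5 : p * q + p * q + p = 0 := by
    refine eq_zero_of_add_self_add_self ?_
    have : p * q + p * q + p + (p * q + p * q + p) + (p * q + p * q + p)
      = (p * q + p * q * p + (p + p * q) + (p + p * q))
        + (p * q + p * q * p + (p + p * q) + (p + p * q))
        - (p * q * p + p * q * p + p) := by abel
    rw [this, h2, h4]; simp
  have h6 : p * q = 0 := by
    have := congrArg (· * q) h5
    simp only [add_mul, mul_assoc, hq, zero_mul] at this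
    exact eq_zero_of_add_self_add_self this
  simpa [h6] using h5

end Idempotents

/-! ## Elements of `Fin 3` -/

theorem exists_third : ∀ i j : Fin 3, i ≠ j → ∃ k, k ≠ i ∧ k ≠ j := by decide

theorem sum_fin_three_of_ne {M : Type*} [AddCommMonoid M] (g : Fin 3 → M) {i j k : Fin 3}
    (hij : i ≠ j) (hki : k ≠ i) (hkj : k ≠ j) : ∑ l, g l = g i + g j + g k := by
  have : (Finset.univ : Finset (Fin 3)) = {i, j, k} := by
    revert i j k; decide
  rw [this, Finset.sum_insert (by simp [hij, hki.symm]), Finset.sum_insert (by simp [hkj.symm]),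
    Finset.sum_singleton, add_assoc]

/-! ## Magic squares and Latin cubes of idempotents -/

section Latin

variable {R : Type*} [Ring R] [Algebra ℂ R]

theorem mul_eq_zero_of_sum_eq_one {g : Fin 3 → R} (hg : ∀ i, g i * g i = g i)
    (h : ∑ i, g i = 1) {i j : Fin 3} (hij : i ≠ j) : g i * g j = 0 := by
  obtain ⟨k, hki, hkj⟩ := exists_third i j hij
  rw [sum_fin_three_of_ne g hij hki hkj] at h
  exact mul_eq_zero_of_add_add_eq_one (hg i) (hg j) (hg k) h

/-- The entries of a `3 × 3` magic square of idempotents commute. -/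
theorem magic_commute {u : Fin 3 → Fin 3 → R} (hu : ∀ i j, u i j * u i j = u i j)
    (hr : ∀ i, ∑ j, u i j = 1) (hc : ∀ j, ∑ i, u i j = 1) (i j k l : Fin 3) :
    Commute (u i j) (u k l) := by
  have row : ∀ i {j l}, j ≠ l → u i j * u i l = 0 := fun i _ _ h =>
    mul_eq_zero_of_sum_eq_one (hu i) (hr i) h
  have col : ∀ {i k} j, i ≠ k → u i j * u k j = 0 := fun j h =>
    mul_eq_zero_of_sum_eq_one (g := fun i => u i j) (fun i => hu i j) (hc j) h
  by_cases hik : i = k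
  · subst hik
    by_cases hjl : j = l
    · subst hjl; rfl
    · rw [Commute, SemiconjBy, row i hjl, row i (Ne.symm hjl)]
  by_cases hjl : j = l
  · subst hjl
    rw [Commute, SemiconjBy, col j hik, col j (Ne.symm hik)]
  -- both products agree with `u i j * u k l * u i j`
  obtain ⟨m, hmj, hml⟩ := exists_third j l hjl
  have hu' : u k l = 1 - u k j - u k m := by
    rw [← hr k, sum_fin_three_of_ne _ hjl hmj hml]; abel
  -- After row `k` is used to rewrite the middle factor, each of the three terms contains two
  -- distinct entries of one row or column.
  have h1 : u i j * u k l * u i m = 0 := by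
    rw [hu', mul_sub, mul_sub, sub_mul, sub_mul, mul_one, row i hmj.symm, col j hik, mul_assoc,
      col m (Ne.symm hik)]
    simp
  have h2 : u i m * u k l * u i j = 0 := by
    rw [hu', mul_sub, mul_sub, sub_mul, sub_mul, mul_one, row i hmj, col m hik, mul_assoc,
      col j (Ne.symm hik)]
    simp
  have e1 : u i j * u k l = u i j * u k l * u i j := by
    conv_lhs => rw [← mul_one (u i j * u k l), ← hr i, sum_fin_three_of_ne _ hjl hmj hml]
    rw [mul_add, mul_add, h1, mul_assoc _ _ (u i l), col l (Ne.symm hik)]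
    simp
  have e2 : u k l * u i j = u i j * u k l * u i j := by
    conv_lhs => rw [← one_mul (u k l * u i j), ← hr i, sum_fin_three_of_ne _ hjl hmj hml]
    rw [add_mul, add_mul, ← mul_assoc, ← mul_assoc, ← mul_assoc, h2, col l hik]
    simp
  rw [Commute, SemiconjBy, e1, e2]

/-- The entries of a `3 × 3 × 3` Latin cube of idempotents commute. -/
theorem latin_commute {E : Fin 3 → Fin 3 → Fin 3 → R} (hE : ∀ c i j, E c i j * E c i j = E c i j)
    (h1 : ∀ i j, ∑ c, E c i j = 1) (h2 : ∀ c j, ∑ i, E c i j = 1) (h3 : ∀ c i, ∑ j, E c i j = 1)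
    (c i j d k l : Fin 3) : Commute (E c i j) (E d k l) := by
  -- Every slice of the cube is a magic square, so entries that share an index commute. Only entries
  -- differing in all three indices remain.
  have sc : ∀ c i j k l, Commute (E c i j) (E c k l) := fun c =>
    magic_commute (hE c) (h3 c) (h2 c)
  have si : ∀ c d i j l, Commute (E c i j) (E d i l) := fun c d i j l =>
    magic_commute (u := fun c j => E c i j) (fun c j => hE c i j) (fun c => h3 c i)
      (fun j => h1 i j) c j d l
  have sj : ∀ c d i k j, Commute (E c i j) (E d k j) := fun c d i k j =>
    magic_commute (u := fun c i => E c i j) (fun c i => hE c i j) (fun c => h2 c j)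
      (fun i => h1 i j) c i d k
  by_cases hcd : c = d
  · subst hcd; exact sc _ _ _ _ _
  by_cases hik : i = k
  · subst hik; exact si _ _ _ _ _
  by_cases hjl : j = l
  · subst hjl; exact sj _ _ _ _ _
  obtain ⟨m, hmj, hml⟩ := exists_third j l hjl
  -- The commutator of `E c i j` and `E d k l` is fixed by left multiplication with `E c k m`:
  -- inserting row `k` of layer `c` after `E c i j`, the `j` term dies in its column and the `l`
  -- term dies against `E d k l`.
  have key : ∀ {j m : Fin 3}, j ≠ l → m ≠ j → m ≠ l →
      E c i j * E d k l - E d k l * E c i j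
        = E c k m * (E c i j * E d k l - E d k l * E c i j) := by
    intro j m hjl hmj hml
    have a1 : E c i j * E c k j = 0 :=
      mul_eq_zero_of_sum_eq_one (g := fun i => E c i j) (fun i => hE c i j) (h2 c j) hik
    have a2 : E c k l * E d k l = 0 :=
      mul_eq_zero_of_sum_eq_one (g := fun c => E c k l) (fun c => hE c k l) (h1 k l) hcd
    have e : E c i j = E c i j * E c k l + E c i j * E c k m := by
      conv_lhs => rw [← mul_one (E c i j), ← h3 c k, sum_fin_three_of_ne _ hjl hmj hml]
      rw [mul_add, mul_add, a1, zero_add]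
    have l1 : E c i j * E d k l = E c k m * (E c i j * E d k l) := by
      conv_lhs => rw [e]
      rw [add_mul, mul_assoc, a2, mul_zero, zero_add, (sc c i j k m).eq, mul_assoc]
    have l2 : E d k l * E c i j = E c k m * (E d k l * E c i j) := by
      conv_lhs => rw [e]
      rw [mul_add, (sc c i j k l).eq, ← mul_assoc, (si d c k l l).eq, a2, zero_mul, zero_add,
        (sc c i j k m).eq, ← mul_assoc, (si d c k l m).eq, mul_assoc]
    rw [mul_sub, ← l1, ← l2]
  have hX := key hjl hmj hml
  have hY := key hml hmj.symm hjl
  -- The commutators for `j` and `m` are opposite, since `E c i l` commutes with `E d k l`. One is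
  -- fixed by `E c k m` and the other by `E c k j`; these are orthogonal, so both commutators
  -- vanish.
  have hXY : E c i j * E d k l - E d k l * E c i j
      = -(E c i m * E d k l - E d k l * E c i m) := by
    have e : E c i j = 1 - E c i l - E c i m := by
      rw [← h3 c i, sum_fin_three_of_ne _ hjl hmj hml]; abel
    rw [e, sub_mul, sub_mul, mul_sub, mul_sub, (sj c d i k l).eq]
    simp
  have a3 : E c k m * E c k j = 0 := mul_eq_zero_of_sum_eq_one (hE c k) (h3 c k) hmj
  rw [commute_iff_lie_eq, Ring.lie_def, hX, hXY, hY, mul_neg, ← mul_assoc, a3, zero_mul, neg_zero]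

end Latin

/-! ## Identities between commuting idempotents -/

/-- In a commutative ring, an identity between the members of a family of three-valued observables
may be checked on deterministic assignments of values. -/
theorem eq_of_forall_assignment {S ι : Type} [CommRing S] [Fintype ι] (e : Fin 3 → ι → S)
    (he : ∀ c i, e c i * e c i = e c i) (ho : ∀ a b i, a ≠ b → e a i * e b i = 0)
    (hs : ∀ i, ∑ c, e c i = 1) {z w : S}
    (h : ∀ (k : Type) (_ : CommRing k) (φ : S →+* k) (f : ι → Fin 3), Nontrivial k →
      (∀ c i, φ (e c i) = if f i = c then 1 else 0) → φ z = φ w) : z = w := by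
  classical
  have h1 : (1 : S) = ∑ f : ι → Fin 3, ∏ i, e (f i) i := by
    have := Finset.prod_univ_sum (fun _ : ι => (Finset.univ : Finset (Fin 3))) (fun i c => e c i)
    -- Expanding a product of sums equal to `1` yields a partition of unity indexed by the
    -- assignments `f`, so it suffices to compare `z` and `w` after multiplication by each term `π`.
    simpa [hs] using this
  have key : ∀ f : ι → Fin 3, (z - w) * ∏ i, e (f i) i = 0 := by
    intro f
    set π := ∏ i, e (f i) i with hπ
    by_cases h0 : π = 0
    · rw [h0, mul_zero]
    -- Modulo the annihilator of `π` the observables take the deterministic values of `f`, because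
    -- `π` absorbs `e (f i) i` and is killed by the other `e c i`.
    let I : Ideal S := (Ideal.span {π}).annihilator
    have hI : ∀ x, x ∈ I ↔ x * π = 0 := fun x => by
      rw [Submodule.mem_annihilator_span_singleton, smul_eq_mul]
    have hπi : ∀ i, π = e (f i) i * ∏ j ∈ Finset.univ.erase i, e (f j) j := fun i =>
      (Finset.mul_prod_erase _ _ (Finset.mem_univ i)).symm
    have hn : Nontrivial (S ⧸ I) := by
      refine Ideal.Quotient.nontrivial_iff.2 fun hh => h0 ?_
      have := (hI 1).1 ((Ideal.eq_top_iff_one I).1 hh)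
      simpa using this
    have hz := h (S ⧸ I) inferInstance (Ideal.Quotient.mk I) f hn (fun c i => by
      split_ifs with hc
      · rw [← map_one (Ideal.Quotient.mk I), Ideal.Quotient.eq, hI, sub_mul, one_mul, hπi i,
          ← mul_assoc, ← hc, he, sub_self]
      · rw [Ideal.Quotient.eq_zero_iff_mem, hI, hπi i, ← mul_assoc, ho _ _ _ (Ne.symm hc),
          zero_mul])
    exact (hI _).1 (Ideal.Quotient.eq.1 hz)
  have : (z - w) * 1 = 0 := by
    rw [h1, Finset.mul_sum]
    exact Finset.sum_eq_zero fun f _ => key f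
  rwa [mul_one, sub_eq_zero] at this

/-! ## Five mutually exclusive four-outcome measurements -/

section Compression

variable {R : Type*} [Ring R] [Algebra ℂ R]

theorem half_idempotent {E K : R} (hE : E * E = E) (hEK : E * K = K) (hKE : K * E = K)
    (hK : K * K = E) : ((1 / 2 : ℂ) • (E + K)) * ((1 / 2 : ℂ) • (E + K)) = (1 / 2 : ℂ) • (E + K) := by
  rw [smul_mul_smul_comm, mul_add, add_mul, add_mul, hE, hEK, hKE, hK]
  module

/-- If `K` is an involution of the range of `E` that anticommutes with the compression of `t`,
then the spectral projections of `K` compress `t` to zero. -/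
theorem half_mul_mul_half {E K t : R} (hEK : E * K = K) (hK : K * K = E)
    (ht : K * t * E = -(E * t * K)) :
    ((1 / 2 : ℂ) • (E + K)) * t * ((1 / 2 : ℂ) • (E + K)) = 0 := by
  -- Writing the right-hand `K` as `E * K` lets `ht` apply. Now the four terms of `(E + K) t (E +
  -- K)` cancel in pairs.
  have h1 : K * t * K = -(E * t * E) := by
    rw [← congrArg (K * t * ·) hEK]
    rw [← mul_assoc, ht, neg_mul, mul_assoc, hK]
  rw [smul_mul_assoc, smul_mul_smul_comm, mul_add, add_mul, add_mul, add_mul, ht, h1]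
  module

/-- The four projections obtained from an idempotent `E` and from involutions `K`, `L` of the
ranges of `E` and `1 - E`. -/
def fourProj (E K L : R) : Fin 4 → R :=
  ![(1 / 2 : ℂ) • (E + K), (1 / 2 : ℂ) • (E + -K), (1 / 2 : ℂ) • ((1 - E) + L),
    (1 / 2 : ℂ) • ((1 - E) + -L)]

theorem sum_fourProj (E K L : R) : ∑ a, fourProj E K L a = 1 := by
  simp only [fourProj, Fin.sum_univ_four, Matrix.cons_val_zero, Matrix.cons_val_one,
    Matrix.cons_val]
  module

variable {E K L : R} (hE : E * E = E) (hEK : E * K = K) (hKE : K * E = K) (hK : K * K = E)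
  (hEL : E * L = 0) (hLE : L * E = 0) (hL : L * L = 1 - E)

include hE hEK hKE hK hEL hLE hL in
theorem fourProj_idempotent (a : Fin 4) : fourProj E K L a * fourProj E K L a = fourProj E K L a := by
  have hF : (1 - E) * (1 - E) = 1 - E := by rw [mul_sub, mul_one, sub_mul, one_mul, hE]; simp
  have hFL : (1 - E) * L = L := by rw [sub_mul, hEL]; simp
  have hLF : L * (1 - E) = L := by rw [mul_sub, hLE]; simp
  fin_cases a
  · exact half_idempotent hE hEK hKE hK
  · exact half_idempotent hE (by rw [mul_neg, hEK]) (by rw [neg_mul, hKE]) (by rw [neg_mul_neg, hK])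
  · exact half_idempotent hF hFL hLF hL
  · exact half_idempotent hF (by rw [mul_neg, hFL]) (by rw [neg_mul, hLF]) (by rw [neg_mul_neg, hL])

include hE hEK hKE hK hEL hLE hL in
theorem fourProj_orthogonal {a b : Fin 4} (hab : a ≠ b) :
    fourProj E K L a * fourProj E K L b = 0 := by
  have hKL : K * L = 0 := by rw [← hKE, mul_assoc, hEL, mul_zero]
  have hLK : L * K = 0 := by rw [← hEK, ← mul_assoc, hLE, zero_mul]
  fin_cases a <;> fin_cases b <;>
    first
    | exact absurd rfl hab
    | (simp only [fourProj, Fin.zero_eta, Fin.mk_one, Fin.reduceFinMk, Matrix.cons_val_zero,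
        Matrix.cons_val_one, Matrix.cons_val, smul_mul_smul_comm, mul_add, add_mul, mul_sub,
        sub_mul, mul_neg, neg_mul, mul_one, one_mul, hE, hEK, hKE, hK, hEL, hLE, hL, hKL, hLK]
       module)

include hEK hK hEL hL in
theorem fourProj_compress {t : R} (ht : K * t * E = -(E * t * K))
    (ht' : L * t * (1 - E) = -((1 - E) * t * L)) (a : Fin 4) :
    fourProj E K L a * t * fourProj E K L a = 0 := by
  have hFL : (1 - E) * L = L := by rw [sub_mul, hEL]; simp
  fin_cases a
  · exact half_mul_mul_half hEK hK ht
  · exact half_mul_mul_half (by rw [mul_neg, hEK]) (by rw [neg_mul_neg, hK])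
      (by rw [neg_mul, neg_mul, ht, mul_neg])
  · exact half_mul_mul_half hFL hL ht'
  · exact half_mul_mul_half (by rw [mul_neg, hFL]) (by rw [neg_mul_neg, hL])
      (by rw [neg_mul, neg_mul, ht', mul_neg])

end Compression

/-! ### The module -/

section WordModule

variable {Γ : Type} [AddGroup Γ]

/-- The complex vector space with basis `Γ × {words in the non-zero elements of Γ}`. -/
abbrev WordModule (Γ : Type) [AddGroup Γ] : Type := (Γ × List {g : Γ // g ≠ 0}) →₀ ℂ

/-- The basis vectors. -/
abbrev wordVec (g : Γ) (w : List {g : Γ // g ≠ 0}) : WordModule Γ := Finsupp.single (g, w) 1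

/-- Translation of the first component. -/
def translate (h : Γ) : Module.End ℂ (WordModule Γ) :=
  Finsupp.lmapDomain ℂ ℂ fun p => (h + p.1, p.2)

/-- The sign of the word length. -/
def wordSign : Module.End ℂ (WordModule Γ) :=
  Finsupp.linearCombination ℂ fun p => (-1 : ℂ) ^ p.2.length • wordVec p.1 p.2

theorem WordModule.end_ext {S T : Module.End ℂ (WordModule Γ)}
    (h : ∀ g w, S (wordVec g w) = T (wordVec g w)) : S = T := by
  refine Finsupp.lhom_ext' fun p => LinearMap.ext_ring ?_
  exact h p.1 p.2

theorem translate_wordVec (h g : Γ) (w) : translate h (wordVec g w) = wordVec (h + g) w := by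
  simp [translate, wordVec, Finsupp.mapDomain_single]

theorem wordSign_wordVec (g : Γ) (w) :
    wordSign (wordVec g w) = (-1 : ℂ) ^ w.length • wordVec g w := by
  simp [wordSign, wordVec, Finsupp.linearCombination_single]

theorem translate_mul (h k : Γ) : translate h * translate k = translate (h + k) :=
  WordModule.end_ext fun g w => by
    simp only [Module.End.mul_apply, translate_wordVec, add_assoc]

theorem translate_zero : translate (0 : Γ) = 1 :=
  WordModule.end_ext fun g w => by simp only [translate_wordVec, zero_add, Module.End.one_apply]

variable [DecidableEq Γ]

/-- The idempotent that moves the first component into the word. -/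
def absorb : Module.End ℂ (WordModule Γ) :=
  Finsupp.lmapDomain ℂ ℂ fun p => (0, if h : p.1 = 0 then p.2 else ⟨p.1, h⟩ :: p.2)

/-- The values on basis vectors of an involution of the kernel of `absorb`. -/
def reflectVec : Γ → List {g : Γ // g ≠ 0} → WordModule Γ
  | g, [] => (1 - absorb) (wordVec g [])
  | h, g :: w => if h = 0 then 0 else
      reflectVec (h + g.1) w + (1 - absorb) (translate h (reflectVec g.1 w))

/-- An involution of the kernel of `absorb`, extended by zero. -/
def reflect : Module.End ℂ (WordModule Γ) :=
  Finsupp.linearCombination ℂ fun p => reflectVec p.1 p.2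

theorem absorb_wordVec_zero (w) : absorb (wordVec (0 : Γ) w) = wordVec 0 w := by
  simp [absorb, wordVec, Finsupp.mapDomain_single]

theorem absorb_wordVec (g : {g : Γ // g ≠ 0}) (w) :
    absorb (wordVec g.1 w) = wordVec 0 (g :: w) := by
  simp [absorb, wordVec, Finsupp.mapDomain_single, g.2]

theorem reflect_wordVec (g : Γ) (w) : reflect (wordVec g w) = reflectVec g w := by
  simp [reflect, wordVec, Finsupp.linearCombination_single]

theorem exists_absorb_wordVec (g : Γ) (w) : ∃ v, absorb (wordVec g w) = wordVec 0 v := by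
  by_cases hg : g = 0
  · subst hg; exact ⟨_, absorb_wordVec_zero w⟩
  · exact ⟨_, absorb_wordVec ⟨g, hg⟩ w⟩

theorem absorb_mul_absorb : (absorb : Module.End ℂ (WordModule Γ)) * absorb = absorb :=
  WordModule.end_ext fun g w => by
    obtain ⟨v, hv⟩ := exists_absorb_wordVec g w
    rw [Module.End.mul_apply, hv, absorb_wordVec_zero]

theorem absorb_mul_sign_mul_absorb :
    (absorb : Module.End ℂ (WordModule Γ)) * (wordSign * absorb) = wordSign * absorb :=
  WordModule.end_ext fun g w => by
    obtain ⟨v, hv⟩ := exists_absorb_wordVec g w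
    simp only [Module.End.mul_apply, hv, wordSign_wordVec, map_smul, absorb_wordVec_zero]

theorem sign_mul_absorb_mul_self :
    (wordSign * absorb : Module.End ℂ (WordModule Γ)) * (wordSign * absorb) = absorb :=
  WordModule.end_ext fun g w => by
    obtain ⟨v, hv⟩ := exists_absorb_wordVec g w
    simp only [Module.End.mul_apply, hv, wordSign_wordVec, map_smul, absorb_wordVec_zero, smul_smul,
      ← pow_add, ← two_mul, pow_mul, neg_one_sq, one_pow, one_smul]

/-- On the range of `absorb`, translating by a nonzero `h` and absorbing again prepends one letter
to the word, which flips the parity of its length. -/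
theorem sign_anticommute {h : Γ} (hh : h ≠ 0) :
    (wordSign * absorb : Module.End ℂ (WordModule Γ)) * translate h * absorb
      = -(absorb * translate h * (wordSign * absorb)) :=
  WordModule.end_ext fun g w => by
    obtain ⟨v, hv⟩ := exists_absorb_wordVec g w
    have := absorb_wordVec ⟨h, hh⟩ v
    simp only [Module.End.mul_apply, LinearMap.neg_apply, hv, wordSign_wordVec, map_smul,
      translate_wordVec, add_zero, this, List.length_cons, pow_succ, mul_neg_one, neg_smul]

theorem reflectVec_zero (w) : reflectVec (0 : Γ) w = 0 := by
  cases w with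
  | nil =>
    rw [reflectVec, LinearMap.sub_apply, absorb_wordVec_zero, Module.End.one_apply, sub_self]
  | cons g w => rw [reflectVec, if_pos rfl]

theorem absorb_compl_absorb (v : WordModule Γ) : absorb ((1 - absorb) v) = 0 := by
  have := congrArg (fun T : Module.End ℂ (WordModule Γ) => T v) absorb_mul_absorb
  simp only [Module.End.mul_apply] at this
  rw [LinearMap.sub_apply, map_sub, this, Module.End.one_apply, sub_self]

theorem absorb_reflectVec (g : Γ) (w) : absorb (reflectVec g w) = 0 := by
  induction w generalizing g with
  | nil => rw [reflectVec, absorb_compl_absorb]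
  | cons k w ih =>
    rw [reflectVec]
    split_ifs with h
    · exact map_zero _
    · rw [map_add, ih, absorb_compl_absorb, add_zero]

theorem absorb_mul_reflect : (absorb : Module.End ℂ (WordModule Γ)) * reflect = 0 :=
  WordModule.end_ext fun g w => by
    rw [Module.End.mul_apply, reflect_wordVec, absorb_reflectVec, LinearMap.zero_apply]

theorem reflect_mul_absorb : (reflect : Module.End ℂ (WordModule Γ)) * absorb = 0 :=
  WordModule.end_ext fun g w => by
    obtain ⟨v, hv⟩ := exists_absorb_wordVec g w
    rw [Module.End.mul_apply, hv, reflect_wordVec, reflectVec_zero, LinearMap.zero_apply]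

theorem compl_absorb_wordVec (g : {g : Γ // g ≠ 0}) (w) :
    (1 - absorb) (wordVec g.1 w) = wordVec g.1 w - wordVec 0 (g :: w) := by
  rw [LinearMap.sub_apply, absorb_wordVec, Module.End.one_apply]

theorem compl_absorb_wordVec_zero (w) : (1 - absorb) (wordVec (0 : Γ) w) = 0 := by
  rw [LinearMap.sub_apply, absorb_wordVec_zero, Module.End.one_apply, sub_self]

/-- The recursion for `reflectVec` is this relation solved for the longer word: applied to `wordVec
g w` with `g ≠ 0`, it expresses `reflectVec h (g :: w)` through values on `w`. -/
theorem reflect_anticommute {h : Γ} (hh : h ≠ 0) :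
    (reflect : Module.End ℂ (WordModule Γ)) * translate h * (1 - absorb)
      = -((1 - absorb) * translate h * reflect) :=
  WordModule.end_ext fun g w => by
    simp only [Module.End.mul_apply, LinearMap.neg_apply, reflect_wordVec]
    by_cases hg : g = 0
    · subst hg
      rw [compl_absorb_wordVec_zero, reflectVec_zero]
      simp only [map_zero, neg_zero]
    · rw [compl_absorb_wordVec ⟨g, hg⟩, map_sub, translate_wordVec, translate_wordVec, map_sub,
        reflect_wordVec, reflect_wordVec, add_zero, reflectVec, if_neg hh]
      abel

/-- Induction on the word. On empty words `reflect` acts as `1 - absorb`; for a longer word,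
`reflect_anticommute` is evaluated at the vector `reflectVec k.1 w`, and the two contributions of `h
+ k` cancel. -/
theorem reflect_reflectVec (g : Γ) (w) : reflect (reflectVec g w) = (1 - absorb) (wordVec g w) := by
  have hR : ∀ v : WordModule Γ, reflect ((1 - absorb) v) = reflect v := fun v => by
    have := congrArg (fun T : Module.End ℂ (WordModule Γ) => T v) reflect_mul_absorb
    simp only [Module.End.mul_apply, LinearMap.zero_apply] at this
    rw [LinearMap.sub_apply, map_sub, this, sub_zero, Module.End.one_apply]
  induction w generalizing g with
  | nil =>
    rw [reflectVec, hR, reflect_wordVec, reflectVec]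
  | cons k w ih =>
    rw [reflectVec]
    split_ifs with h
    · subst h; rw [compl_absorb_wordVec_zero, map_zero]
    · have h1 : reflectVec k.1 w = (1 - absorb) (reflectVec k.1 w) := by
        rw [LinearMap.sub_apply, absorb_reflectVec, sub_zero, Module.End.one_apply]
      have h2 := congrArg (fun T : Module.End ℂ (WordModule Γ) => T (reflectVec k.1 w))
        (reflect_anticommute h)
      simp only [Module.End.mul_apply, LinearMap.neg_apply] at h2
      rw [← h1, ih, compl_absorb_wordVec, map_sub, translate_wordVec, translate_wordVec, add_zero,
        map_sub] at h2
      rw [map_add, ih, hR, h2]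
      abel

theorem reflect_mul_self : (reflect : Module.End ℂ (WordModule Γ)) * reflect = 1 - absorb :=
  WordModule.end_ext fun g w => by
    rw [Module.End.mul_apply, reflect_wordVec, reflect_reflectVec]

/-- For every group there are four-outcome measurements `(e_{a,x})_a`, indexed by the group, with
`e_{a,x} e_{a,y} = 0` for `x ≠ y`. -/
theorem exists_exclusive_measurements (Γ : Type) [AddGroup Γ] [DecidableEq Γ] :
    ∃ (R : Type) (_ : Ring R) (_ : Algebra ℂ R) (_ : Nontrivial R) (e : Fin 4 → Γ → R), (∀ a x, e a x * e a x = e a x) ∧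
      (∀ x, ∑ a, e a x = 1) ∧ (∀ a b x, a ≠ b → e a x * e b x = 0) ∧
      ∀ a x y, x ≠ y → e a x * e a y = 0 := by
  have hKE : (wordSign * absorb : Module.End ℂ (WordModule Γ)) * absorb = wordSign * absorb := by
    rw [mul_assoc, absorb_mul_absorb]
  have cancel : ∀ (x : Γ) (p : Module.End ℂ (WordModule Γ)),
      translate (-x) * (translate x * p) = p := fun x p => by
    rw [← mul_assoc, translate_mul, neg_add_cancel, translate_zero, one_mul]
  have : Nontrivial (WordModule Γ) := ⟨⟨wordVec 0 [], 0, by simp [wordVec]⟩⟩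
  -- The measurement for `x` is the conjugate by translation by `x` of one fixed measurement, built
  -- from the sign on the range of `absorb` and `reflect` on its kernel.
  refine ⟨Module.End ℂ (WordModule Γ), inferInstance, inferInstance, inferInstance,
    fun a x => translate x * fourProj absorb (wordSign * absorb) reflect a * translate (-x),
    fun a x => ?_, fun x => ?_, fun a b x hab => ?_, fun a x y hxy => ?_⟩
  · simp only [mul_assoc, cancel]
    rw [← mul_assoc (fourProj _ _ _ a), fourProj_idempotent absorb_mul_absorb
      absorb_mul_sign_mul_absorb hKE sign_mul_absorb_mul_self absorb_mul_reflect reflect_mul_absorb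
      reflect_mul_self]
  · rw [← Finset.sum_mul, ← Finset.mul_sum, sum_fourProj, mul_one, translate_mul, add_neg_cancel,
      translate_zero]
  · simp only [mul_assoc, cancel]
    rw [← mul_assoc (fourProj _ _ _ a), fourProj_orthogonal absorb_mul_absorb
      absorb_mul_sign_mul_absorb hKE sign_mul_absorb_mul_self absorb_mul_reflect reflect_mul_absorb
      reflect_mul_self hab, zero_mul, mul_zero]
  -- Between the two projections stands the translation by `-x + y`, which is nontrivial and
  -- therefore compressed to zero.
  · have hne : -x + y ≠ 0 := fun h => hxy (neg_add_eq_zero.1 h)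
    have := fourProj_compress (R := Module.End ℂ (WordModule Γ)) absorb_mul_sign_mul_absorb
      sign_mul_absorb_mul_self absorb_mul_reflect reflect_mul_self (sign_anticommute hne)
      (reflect_anticommute hne) a
    calc _ = translate x * (fourProj absorb (wordSign * absorb) reflect a
            * (translate (-x) * translate y) * fourProj absorb (wordSign * absorb) reflect a)
            * translate (-y) := by simp only [mul_assoc]
      _ = 0 := by rw [translate_mul, this, mul_zero, zero_mul]

end WordModule

/-! ## Homomorphisms out of presented algebras -/

section Presented

variable {X : Type} {R : Type*} [Ring R] [Algebra ℂ R]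

/-- The evaluation of the free algebra at a family of elements. -/
def evalHom (f : X → R) : FreeStarAlgebra X →ₐ[ℂ] R := FreeAlgebra.lift ℂ f

theorem evalHom_gen (f : X → R) (x : X) : evalHom f (gen x) = f x :=
  FreeAlgebra.lift_ι_apply f x

theorem starCon_le_ker (S : Set (FreeStarAlgebra X)) (f : X → R)
    (h : ∀ r, r ∈ S ∨ star r ∈ S → evalHom f r = 0) {a b : FreeStarAlgebra X}
    (hab : starCon S a b) : evalHom f a = evalHom f b := by
  have hle : starCon S ≤ RingCon.ker (evalHom f).toRingHom := by
    refine RingCon.ringConGen_le.2 ?_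
    rintro a b ⟨rfl, hr⟩
    exact (h a hr).trans (map_zero (evalHom f)).symm
  exact hle hab

/-- The witness `R` needs no involution, provided that the adjoints of the relations hold in it as
well. This matters because the exclusive measurements live in a plain endomorphism algebra. -/
theorem nontrivial_presented [Nontrivial R] (S : Set (FreeStarAlgebra X)) (f : X → R)
    (h : ∀ r, r ∈ S ∨ star r ∈ S → evalHom f r = 0) : Nontrivial (Presented S) := by
  refine ⟨⟨((1 : FreeStarAlgebra X) : (starCon S).Quotient),
    ((0 : FreeStarAlgebra X) : (starCon S).Quotient), fun h1 => ?_⟩⟩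
  have := starCon_le_ker S f h ((RingCon.eq _).1 h1)
  rw [map_one, map_zero] at this
  exact one_ne_zero this

/-- The projection onto a presented algebra. -/
def Presented.mk (S : Set (FreeStarAlgebra X)) : FreeStarAlgebra X →+* Presented S :=
  (starCon S).mk'

theorem Presented.mk_eq_zero {S : Set (FreeStarAlgebra X)} {r : FreeStarAlgebra X} (hr : r ∈ S) :
    Presented.mk S r = 0 :=
  (RingCon.eq (starCon S)).2 (RingConGen.Rel.of _ _ ⟨rfl, Or.inl hr⟩)

theorem Presented.star_mk (S : Set (FreeStarAlgebra X)) (r : FreeStarAlgebra X) :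
    star (Presented.mk S r) = Presented.mk S (star r) := rfl

theorem evalHom_star [StarRing R] [StarModule ℂ R] (f : X → R) (hf : ∀ x, star (f x) = f x)
    (a : FreeStarAlgebra X) : evalHom f (star a) = star (evalHom f a) := by
  induction a using FreeStarAlgebra.induction with
  | h1 c => rw [star_free_algebraMap, AlgHom.commutes, AlgHom.commutes, algebraMap_star_comm]
  | h2 x => rw [star_gen, evalHom_gen, hf]
  | h3 a b ha hb => rw [star_mul, map_mul, map_mul, star_mul, ha, hb]
  | h4 a b ha hb => rw [star_add, map_add, map_add, star_add, ha, hb]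

/-- The universal property of a presented `*`-algebra. -/
theorem nonempty_presented_hom [StarRing R] [StarModule ℂ R] (S : Set (FreeStarAlgebra X))
    (f : X → R) (hf : ∀ x, star (f x) = f x) (h : ∀ r ∈ S, evalHom f r = 0) :
    Nonempty (Presented S →⋆ₐ[ℂ] R) := by
  have h' : ∀ r, r ∈ S ∨ star r ∈ S → evalHom f r = 0 := by
    rintro r (hr | hr)
    · exact h r hr
    · rw [← star_star r, evalHom_star f hf, h _ hr, star_zero]
  refine ⟨{ toFun := Quotient.lift (evalHom f) fun a b hab => starCon_le_ker S f h' hab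
            map_one' := map_one (evalHom f)
            map_zero' := map_zero (evalHom f)
            map_mul' := ?_
            map_add' := ?_
            commutes' := (evalHom f).commutes
            map_star' := ?_ }⟩
  · rintro ⟨a⟩ ⟨b⟩
    exact map_mul (evalHom f) a b
  · rintro ⟨a⟩ ⟨b⟩
    exact map_add (evalHom f) a b
  · rintro ⟨a⟩
    exact evalHom_star f hf a

end Presented

/-! ## Colorings by idempotents -/

/-- A coloring of a graph by idempotents of a ring. -/
structure IsColoring {V R : Type*} [Ring R] (G : SimpleGraph V) {c : ℕ} (e : Fin c → V → R) :
    Prop where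
  idem : ∀ a x, e a x * e a x = e a x
  sum_eq_one : ∀ x, ∑ a, e a x = 1
  orth : ∀ {a b} x, a ≠ b → e a x * e b x = 0
  adj : ∀ a {x y}, G.Adj x y → e a x * e a y = 0

namespace IsColoring

variable {V : Type} {R : Type*} [Ring R] {G : SimpleGraph V}

/-- A graph that contains a triangle needs at least three colors. -/
theorem three_le [Nontrivial R] {c : ℕ} {e : Fin c → V → R} (h : IsColoring G e) {x y z : V}
    (hxy : G.Adj x y) (hyz : G.Adj y z) (hxz : G.Adj x z) : 3 ≤ c := by
  by_contra hc
  have h1 : (1 : R) ≠ 0 := one_ne_zero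
  interval_cases c
  · exact h1 (by simpa using (h.sum_eq_one x).symm)
  · have e1 := h.sum_eq_one x
    have e2 := h.sum_eq_one y
    rw [Fin.sum_univ_one] at e1 e2
    have := h.adj 0 hxy
    rw [e1, e2, one_mul] at this
    exact h1 this
  -- Color `a` at `x` forces `b` at `y`, which forces `a` at `z`; but `x` and `z` are adjacent.
  · have key : ∀ a b : Fin 2, a ≠ b → e a x = 0 := by
      intro a b hab
      have hs : ∀ v, e a v + e b v = 1 := fun v => by
        rw [← h.sum_eq_one v, Fin.sum_univ_two]
        fin_cases a <;> fin_cases b <;> first | exact absurd rfl hab | rfl | exact add_comm _ _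
      have e1 : e a x = e a x * e b y := by
        conv_lhs => rw [← mul_one (e a x), ← hs y, mul_add, h.adj a hxy, zero_add]
      have e2 : e b y = e b y * e a z := by
        conv_lhs => rw [← mul_one (e b y), ← hs z, mul_add, h.adj b hyz, add_zero]
      have e3 : e a x = e a x * e a z := by
        conv_lhs => rw [e1, e2, ← mul_assoc, ← e1]
      rw [e3, h.adj a hxz]
    refine h1 ?_
    rw [← h.sum_eq_one x, Fin.sum_univ_two, key 0 1 (by decide), key 1 0 (by decide), add_zero]

/-- With three colors, the idempotents at adjacent vertices commute. -/
theorem commute_of_adj {e : Fin 3 → V → R} (h : IsColoring G e) {x y : V} (hxy : G.Adj x y)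
    (a b : Fin 3) : Commute (e a x) (e b y) := by
  by_cases hab : a = b
  · subst hab
    rw [Commute, SemiconjBy, h.adj a hxy, h.adj a hxy.symm]
  obtain ⟨c, hca, hcb⟩ := exists_third a b hab
  have hy : e b y = 1 - e a y - e c y := by
    rw [← h.sum_eq_one y, sum_fin_three_of_ne _ hab hca hcb]; abel
  -- Replacing `e b y` by the complement of the other two colors makes every term vanish, so `e b y`
  -- has no off-diagonal part between the colors `a` and `c` at `x`.
  have h1 : e a x * e b y * e c x = 0 := by
    rw [hy, mul_sub, mul_sub, mul_one, h.adj a hxy, sub_zero, sub_mul, h.orth x hca.symm,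
      mul_assoc, h.adj c hxy.symm]
    simp
  have h2 : e c x * e b y * e a x = 0 := by
    rw [hy, mul_sub, mul_sub, mul_one, h.adj c hxy, sub_zero, sub_mul, h.orth x hca,
      mul_assoc, h.adj a hxy.symm]
    simp
  have e1 : e a x * e b y = e a x * e b y * e a x := by
    conv_lhs => rw [← mul_one (e a x * e b y), ← h.sum_eq_one x, sum_fin_three_of_ne _ hab hca hcb,
      mul_add, mul_add, h1, mul_assoc _ _ (e b x), h.adj b hxy.symm, mul_zero, add_zero, add_zero]
  have e2 : e b y * e a x = e a x * e b y * e a x := by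
    conv_lhs => rw [← one_mul (e b y * e a x), ← h.sum_eq_one x, sum_fin_three_of_ne _ hab hca hcb,
      add_mul, add_mul, ← mul_assoc, ← mul_assoc, ← mul_assoc, h2, h.adj b hxy, zero_mul, add_zero,
      add_zero]
  rw [Commute, SemiconjBy, e1, e2]

end IsColoring

theorem isColoring_lc {V : Type} (G : SimpleGraph V) (c : ℕ) :
    IsColoring G (fun (a : Fin c) x => Presented.mk (lcRelations G c) (gen (a, x))) where
  idem a x := by
    have := Presented.mk_eq_zero (S := lcRelations G c) (Or.inl ⟨a, x, rfl⟩)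
    rwa [map_sub, map_mul, sub_eq_zero] at this
  sum_eq_one x := by
    have := Presented.mk_eq_zero (S := lcRelations G c) (Or.inr (Or.inl ⟨x, rfl⟩))
    rwa [map_sub, map_sum, map_one, sub_eq_zero] at this
  orth {a b} x hab := by
    have := Presented.mk_eq_zero (S := lcRelations G c) (Or.inr (Or.inr (Or.inl ⟨a, b, x, hab, rfl⟩)))
    rwa [map_mul] at this
  adj a {x y} hxy := by
    have := Presented.mk_eq_zero (S := lcRelations G c)
      (Or.inr (Or.inr (Or.inr (Or.inl ⟨a, x, y, hxy, rfl⟩))))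
    rwa [map_mul] at this

/-- For three colors the local commutation relations come for free from `commute_of_adj`, and all
relations are stable under reversal of products, so an arbitrary coloring by idempotents is enough.
-/
theorem IsColoring.nontrivial_lc {V : Type} {R : Type*} [Ring R] [Algebra ℂ R] [Nontrivial R]
    {G : SimpleGraph V} {e : Fin 3 → V → R} (h : IsColoring G e) :
    Nontrivial (Presented (lcRelations G 3)) := by
  refine nontrivial_presented _ (fun p => e p.1 p.2) ?_
  have hc : ∀ a b x y, G.Adj x y → e a x * e b y - e b y * e a x = 0 := fun a b x y hxy =>
    sub_eq_zero.2 (h.commute_of_adj hxy a b)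
  rintro r (hr | hr)
  · rcases hr with ⟨a, x, rfl⟩ | ⟨x, rfl⟩ | ⟨a, b, x, hab, rfl⟩ | ⟨a, x, y, hxy, rfl⟩ |
      ⟨a, b, x, y, hxy, rfl⟩
    · simp only [map_sub, map_mul, evalHom_gen, h.idem, sub_self]
    · simp only [map_sub, map_sum, map_one, evalHom_gen, h.sum_eq_one, sub_self]
    · simp only [map_mul, evalHom_gen, h.orth x hab]
    · simp only [map_mul, evalHom_gen, h.adj a hxy]
    · simp only [map_sub, map_mul, evalHom_gen, hc a b x y hxy]
  · rw [← star_star r]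
    rcases hr with ⟨a, x, hr⟩ | ⟨x, hr⟩ | ⟨a, b, x, hab, hr⟩ | ⟨a, x, y, hxy, hr⟩ |
      ⟨a, b, x, y, hxy, hr⟩ <;> rw [hr]
    · simp only [star_sub, star_mul, star_gen, map_sub, map_mul, evalHom_gen, h.idem, sub_self]
    · simp only [star_sub, star_sum, star_one, star_gen, map_sub, map_sum, map_one, evalHom_gen,
        h.sum_eq_one, sub_self]
    · simp only [star_mul, star_gen, map_mul, evalHom_gen, h.orth x hab.symm]
    · simp only [star_mul, star_gen, map_mul, evalHom_gen, h.adj a hxy.symm]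
    · simp only [star_sub, star_mul, star_gen, map_sub, map_mul, evalHom_gen, hc b a y x hxy.symm]

/-! ## Coarse-grainings of measurements -/

section Mix

variable {R Ω : Type} [Ring R] [Fintype Ω]

/-- The coarse-graining of a measurement `π` along a map from outcomes to colors. -/
def mix (π : Ω → R) (f : Ω → Fin 3) (c : Fin 3) : R := ∑ o, if f o = c then π o else 0

theorem sum_mix (π : Ω → R) (hs : ∑ o, π o = 1) (f : Ω → Fin 3) : ∑ c, mix π f c = 1 := by
  unfold mix
  rw [Finset.sum_comm]
  simpa using hs

theorem mix_const (π : Ω → R) (hs : ∑ o, π o = 1) (k c : Fin 3) :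
    mix π (fun _ => k) c = if k = c then 1 else 0 := by
  unfold mix
  split_ifs with h
  · exact hs
  · exact Finset.sum_const_zero

theorem mix_eq_ite [DecidableEq Ω] (π : Ω → R) (hs : ∑ o, π o = 1) (f : Ω → Fin 3) (a : Ω)
    {d : Fin 3} (hd : d ≠ 0) (hf : ∀ o, f o = if o = a then 0 else d) (c : Fin 3) :
    mix π f c = if c = 0 then π a else if c = d then 1 - π a else 0 := by
  have h : 1 - π a = ∑ o ∈ Finset.univ.erase a, π o := by
    rw [← hs, ← Finset.add_sum_erase _ _ (Finset.mem_univ a), add_sub_cancel_left]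
  rw [mix, ← Finset.add_sum_erase _ _ (Finset.mem_univ a), hf, if_pos rfl]
  have h' : ∑ o ∈ Finset.univ.erase a, (if f o = c then π o else 0)
      = ∑ o ∈ Finset.univ.erase a, (if d = c then π o else 0) :=
    Finset.sum_congr rfl fun o ho => by rw [hf, if_neg (Finset.ne_of_mem_erase ho)]
  rw [h']
  by_cases h0 : c = 0
  · subst h0
    simp [hd]
  · by_cases h1 : c = d
    · subst h1
      simp [h0, Ne.symm h0, h]
    · simp [h0, Ne.symm h0, h1, Ne.symm h1]

variable {π : Ω → R} (hi : ∀ o, π o * π o = π o) (ho : ∀ o p, o ≠ p → π o * π p = 0)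

include hi ho in
theorem mix_mul_mix (f g : Ω → Fin 3) (c d : Fin 3) :
    mix π f c * mix π g d = ∑ o, if f o = c ∧ g o = d then π o else 0 := by
  unfold mix
  rw [Finset.sum_mul_sum]
  refine Finset.sum_congr rfl fun o _ => ?_
  rw [Finset.sum_eq_single o]
  · by_cases h1 : f o = c <;> by_cases h2 : g o = d <;> simp [h1, h2, hi]
  · intro p _ hp
    split_ifs <;> simp [ho o p hp.symm]
  · simp

include hi ho in
theorem mix_idem (f : Ω → Fin 3) (c : Fin 3) : mix π f c * mix π f c = mix π f c := by
  rw [mix_mul_mix hi ho]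
  simp only [and_self, mix]

include hi ho in
theorem mix_mul_mix_of_ne (f g : Ω → Fin 3) (h : ∀ o, f o ≠ g o) (c : Fin 3) :
    mix π f c * mix π g c = 0 := by
  rw [mix_mul_mix hi ho]
  refine Finset.sum_eq_zero fun o _ => if_neg fun hh => h o (hh.1.trans hh.2.symm)

include hi ho in
theorem mix_orth (f : Ω → Fin 3) {c d : Fin 3} (h : c ≠ d) : mix π f c * mix π f d = 0 := by
  rw [mix_mul_mix hi ho]
  refine Finset.sum_eq_zero fun o _ => if_neg fun hh => h (hh.1.symm.trans hh.2)

end Mix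

/-! ## The coloring of the reduction graph -/

/-- The asymmetric form of the game `Hom(K₅, K₄)`. -/
abbrev exclusiveGame : SyncGame (Fin 5) (Fin 4) :=
  (homGame (⊤ : SimpleGraph (Fin 5)) (⊤ : SimpleGraph (Fin 4))).asymmetric

theorem exclusiveGame_not_rule {a b : Fin 4} {x y : Fin 5} (hxy : x ≠ y)
    (h : ¬ exclusiveGame.rule a b x y) : a = b := by
  by_contra hab
  refine h ⟨fun h => absurd h hxy, fun _ => ⟨⟨fun h => absurd h hxy, fun _ => hab⟩,
    ⟨fun h => absurd h.symm hxy, fun _ => fun h => hab h.symm⟩⟩⟩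

/-- The three colorings of the rook's graphs `v` with `v 0 1` colored `1`. -/
def rookColor : Fin 3 → Fin 3 → Fin 3 → Fin 3 :=
  ![fun i j => i + j, fun i j => 2 - j + i, fun i j => 2 - i - j]

/-- The three colorings of the prism vertices. -/
def prismColor : Fin 3 → Fin 2 → Fin 3 := ![![2, 1], ![1, 2], ![1, 2]]

/-- The coloring of the rook's graph `v` used for a given answer. -/
def branch : Fin 2 → Fin 4 → Fin 3 := ![![0, 1, 2, 2], ![0, 0, 1, 2]]

/-- The color of the vertex of an answer that is not given. -/
def offColor : Fin 4 → Fin 3 := ![2, 1, 1, 2]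

/-- The colorings of the rook's graphs `q`, in the cases that the first answer is given, that the
second one is given, and that neither is given. -/
def linkColor (a : Fin 4) : Fin 3 → Fin 3 → Fin 3 → Fin 3 :=
  ![fun i j => ![0, -offColor a, offColor a] (i + j),
    fun i j => ![offColor a, -offColor a, 0] (i + j),
    fun i j => ![offColor a, -offColor a, 0] (j - i)]

section Coloring

variable {R : Type} [Ring R] (P : Fin 4 → Fin 5 → R)

/-- The measurement with outcomes "answer `a` to `x`", "answer `a` to `y`" and "neither". -/
def linkMeas (a : Fin 4) (x y : Fin 5) : Fin 3 → R := ![P a x, P a y, 1 - P a x - P a y]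

/-- The color observables of the vertices of the graph. -/
def rawColor : RawVertex (n := 5) (m := 1) exclusiveGame → Fin 3 → R
  | .A => fun c => if 0 = c then 1 else 0
  | .B => fun c => if 1 = c then 1 else 0
  | .C => fun c => if 2 = c then 1 else 0
  | .v i j α x => mix (fun a => P a x) fun a => rookColor (branch α a) i j
  | .t s α x => mix (fun a => P a x) fun a => prismColor (branch α a) s
  | .q i j a _ x y _ => mix (linkMeas P a x y) fun o => linkColor a o i j

variable {P} (hi : ∀ a x, P a x * P a x = P a x) (hs : ∀ x, ∑ a, P a x = 1)
  (ho : ∀ a b x, a ≠ b → P a x * P b x = 0) (he : ∀ a x y, x ≠ y → P a x * P a y = 0)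

include hs in
-- The vertex of an answer has the color of `A` when that answer is given, and otherwise one fixed
-- color. Its observables thus involve `P a x` only, which makes the colorings of the `v` and `q`
-- gadgets match where they are glued.
theorem rawColor_hat (a : Fin 4) (x : Fin 5) (c : Fin 3) :
    rawColor P (RawVertex.hat (n := 5) (m := 1) exclusiveGame a x) c
      = if c = 0 then P a x else if c = offColor a then 1 - P a x else 0 := by
  fin_cases a <;> exact mix_eq_ite (fun a => P a x) (hs x) _ _ (by decide) (by decide) c

theorem sum_linkMeas (a : Fin 4) (x y : Fin 5) : ∑ o, linkMeas P a x y o = 1 := by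
  simp [Fin.sum_univ_three, linkMeas]

include hi he in
-- Exclusivity enters here: "neither" is an idempotent outcome because `P a x` and `P a y` are
-- orthogonal in both orders.
theorem linkMeas_idem (a : Fin 4) {x y : Fin 5} (hxy : x ≠ y) (o : Fin 3) :
    linkMeas P a x y o * linkMeas P a x y o = linkMeas P a x y o := by
  fin_cases o
  · exact hi a x
  · exact hi a y
  · simp [linkMeas, mul_sub, sub_mul, hi, he a x y hxy, he a y x hxy.symm]

include hi he in
theorem linkMeas_orth (a : Fin 4) {x y : Fin 5} (hxy : x ≠ y) (o p : Fin 3) (hop : o ≠ p) :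
    linkMeas P a x y o * linkMeas P a x y p = 0 := by
  fin_cases o <;> fin_cases p <;> first
    | exact absurd rfl hop
    | simp [linkMeas, mul_sub, sub_mul, hi, he a x y hxy, he a y x hxy.symm]

theorem offColor_ne_zero : ∀ a, offColor a ≠ 0 := by decide

include hs in
theorem rawColor_ident {u w : RawVertex (n := 5) (m := 1) exclusiveGame}
    (h : RawVertex.Ident exclusiveGame u w) : rawColor P u = rawColor P w := by
  funext c
  cases h with
  | v12 α x =>
    have : (fun a => rookColor (branch α a) 0 1) = fun _ => 1 := by
      fin_cases α <;> decide
    change mix _ (fun a => rookColor (branch α a) 0 1) c = if 1 = c then 1 else 0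
    rw [this, mix_const _ (hs x)]
  | chain α x =>
    have : (fun a => rookColor (branch α.castSucc a) 2 1)
        = fun a => rookColor (branch α.succ a) 0 0 := by
      fin_cases α; decide
    change mix _ (fun a => rookColor (branch α.castSucc a) 2 1) c
      = mix _ (fun a => rookColor (branch α.succ a) 0 0) c
    rw [this]
  | q11 a b x y h =>
    rw [rawColor_hat hs]
    refine mix_eq_ite _ (sum_linkMeas a x y) _ 0 (offColor_ne_zero a) ?_ c
    clear h; revert a; decide
  | q22 a b x y h =>
    have hab : a = b := h.elim (fun h => exclusiveGame_not_rule h.2.1 h.1)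
      (fun h => exclusiveGame_not_rule h.2.1 h.1)
    subst hab
    rw [rawColor_hat hs]
    refine mix_eq_ite _ (sum_linkMeas a x y) _ 1 (offColor_ne_zero a) ?_ c
    clear h; revert a; decide
  | q12E a b x y h =>
    have : (fun o => linkColor a o 0 1) = fun _ => 1 := by
      rcases h.2.2.1 with rfl | rfl <;> decide
    change mix _ (fun o => linkColor a o 0 1) c = if 1 = c then 1 else 0
    rw [this, mix_const _ (sum_linkMeas a x y)]
  | q12F a b x y h =>
    have : (fun o => linkColor a o 0 1) = fun _ => 2 := by
      have h1 := h.2.2.1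
      unfold IsExtreme at h1
      revert h1
      clear h
      revert a
      decide
    change mix _ (fun o => linkColor a o 0 1) c = if 2 = c then 1 else 0
    rw [this, mix_const _ (sum_linkMeas a x y)]

include hi hs ho he in
theorem rawColor_edge {u w : RawVertex (n := 5) (m := 1) exclusiveGame}
    (h : RawVertex.Edge exclusiveGame u w) (c : Fin 3) :
    rawColor P u c * rawColor P w c = 0 ∧ rawColor P w c * rawColor P u c = 0 := by
  have hx : ∀ x (f g : Fin 4 → Fin 3), (∀ a, f a ≠ g a) →
      mix (fun a => P a x) f c * mix (fun a => P a x) g c = 0 ∧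
      mix (fun a => P a x) g c * mix (fun a => P a x) f c = 0 := fun x f g hfg =>
    ⟨mix_mul_mix_of_ne (fun a => hi a x) (fun a b => ho a b x) f g hfg c,
      mix_mul_mix_of_ne (fun a => hi a x) (fun a b => ho a b x) g f (fun a => (hfg a).symm) c⟩
  have hq : ∀ a x y, x ≠ y → ∀ f g : Fin 3 → Fin 3, (∀ o, f o ≠ g o) →
      mix (linkMeas P a x y) f c * mix (linkMeas P a x y) g c = 0 ∧
      mix (linkMeas P a x y) g c * mix (linkMeas P a x y) f c = 0 := fun a x y hxy f g hfg =>
    ⟨mix_mul_mix_of_ne (linkMeas_idem hi he a hxy) (linkMeas_orth hi he a hxy) f g hfg c,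
      mix_mul_mix_of_ne (linkMeas_idem hi he a hxy) (linkMeas_orth hi he a hxy) g f
        (fun o => (hfg o).symm) c⟩
  have hne : ∀ {a b : Fin 4} {x y : Fin 5}, SetE (m := 1) exclusiveGame a b x y ∨
      SetF (m := 1) exclusiveGame a b x y → x ≠ y := fun h => h.elim (fun h => h.2.1) (fun h => h.2.1)
  cases h with
  | AB => fin_cases c <;> simp [rawColor]
  | BC => fin_cases c <;> simp [rawColor]
  | AC => fin_cases c <;> simp [rawColor]
  | rookV i j i' j' α x h =>
    refine hx x _ _ fun a => ?_
    generalize branch α a = o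
    unfold RookAdj at h
    revert i j i' j' o
    decide
  | Av33 α x =>
    have := hx x (fun _ => 0) (fun a => rookColor (branch α a) 2 2) (by revert α; decide)
    rwa [mix_const _ (hs x)] at this
  | Cv21 α x =>
    have := hx x (fun _ => 2) (fun a => rookColor (branch α a) 1 0) (by revert α; decide)
    rwa [mix_const _ (hs x)] at this
  | prism1 α x => exact hx x _ _ (by revert α; decide)
  | prism2 α x => exact hx x _ _ (by revert α; decide)
  | prismA s α x =>
    have := hx x (fun _ => 0) (fun a => prismColor (branch α a) s) (by revert α s; decide)
    rwa [mix_const _ (hs x)] at this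
  | prismT α x => exact hx x _ _ (by revert α; decide)
  | direct a b x y h hxy hE hF =>
    -- Such edges do not occur: a forbidden tuple with `x ≠ y` repeats its answer, so its two
    -- answers are both extreme or both not.
    have hab := exclusiveGame_not_rule hxy h
    subst hab
    by_cases hext : IsExtreme (m := 1) a
    · exact absurd ⟨h, hxy, hext, hext⟩ hE
    · exact absurd ⟨h, hxy, hext, hext⟩ hF
  | rookQ i j i' j' a b x y h hr =>
    refine hq a x y (hne h) _ _ fun o => ?_
    unfold RookAdj at hr
    clear h
    revert i j i' j' o a
    decide
  | Aq33 a b x y h =>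
    have := hq a x y (hne h) (fun _ => 0) (fun o => linkColor a o 2 2) (by clear h; revert a; decide)
    rwa [mix_const _ (sum_linkMeas a x y)] at this

include hi hs ho he in
theorem rawColor_measurement (u : RawVertex (n := 5) (m := 1) exclusiveGame) :
    (∀ a, rawColor P u a * rawColor P u a = rawColor P u a) ∧ ∑ a, rawColor P u a = 1 ∧
      ∀ a b, a ≠ b → rawColor P u a * rawColor P u b = 0 := by
  have hv : ∀ x f, (∀ c, mix (fun a => P a x) f c * mix (fun a => P a x) f c
        = mix (fun a => P a x) f c) ∧ ∑ c, mix (fun a => P a x) f c = 1 ∧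
      ∀ c d, c ≠ d → mix (fun a => P a x) f c * mix (fun a => P a x) f d = 0 := fun x f =>
    ⟨mix_idem (fun a => hi a x) (fun a b => ho a b x) f, sum_mix _ (hs x) f,
      fun c d h => mix_orth (fun a => hi a x) (fun a b => ho a b x) f h⟩
  have hconst : ∀ k : Fin 3, mix (fun a => P a 0) (fun _ => k)
      = fun c => if k = c then (1 : R) else 0 := fun k => funext fun c => mix_const _ (hs 0) k c
  cases u with
  | A => have := hv 0 fun _ => 0; rwa [hconst] at this
  | B => have := hv 0 fun _ => 1; rwa [hconst] at this
  | C => have := hv 0 fun _ => 2; rwa [hconst] at this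
  | v i j α x => exact hv x _
  | t s α x => exact hv x _
  | q i j a b x y h =>
    have hxy : x ≠ y := h.elim (fun h => h.2.1) (fun h => h.2.1)
    exact ⟨mix_idem (linkMeas_idem hi he a hxy) (linkMeas_orth hi he a hxy) _,
      sum_mix _ (sum_linkMeas a x y) _,
      fun c d h => mix_orth (linkMeas_idem hi he a hxy) (linkMeas_orth hi he a hxy) _ h⟩

include hi hs ho he in
/-- Mutually exclusive measurements give a coloring of the reduction graph. -/
theorem exists_isColoring_reductionGraph :
    ∃ e : Fin 3 → ReductionVertex (n := 5) (m := 1) exclusiveGame → R,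
      IsColoring (reductionGraph (n := 5) (m := 1) exclusiveGame) e := by
  have hraw := rawColor_measurement hi hs ho he
  let col : ReductionVertex (n := 5) (m := 1) exclusiveGame → Fin 3 → R :=
    Quot.lift (rawColor P) fun _ _ h => rawColor_ident hs h
  refine ⟨fun a u => col u a, ⟨?_, ?_, ?_, ?_⟩⟩
  · rintro a ⟨u⟩; exact (hraw u).1 a
  · rintro ⟨u⟩; exact (hraw u).2.1
  · rintro a b ⟨u⟩ hab; exact (hraw u).2.2 a b hab
  · rintro a u w ⟨-, ⟨u, w, rfl, rfl, h⟩ | ⟨u, w, rfl, rfl, h⟩⟩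
    · exact (rawColor_edge hi hs ho he h a).1
    · exact (rawColor_edge hi hs ho he h a).2

end Coloring

/-! ## Consequences of a three-coloring by idempotents -/

/-- A commuting family of elements lives in a commutative ring. -/
theorem exists_commRing_lift {R κ : Type} [Ring R] (e : κ → R) (h : ∀ i j, Commute (e i) (e j)) :
    ∃ (S : Type) (_ : CommRing S) (ψ : S →+* R) (e' : κ → S), Function.Injective ψ ∧
      ∀ i, ψ (e' i) = e i := by
  have := Subring.isMulCommutative_closure (s := Set.range e) (by
    rintro _ ⟨i, rfl⟩ _ ⟨j, rfl⟩
    exact h i j)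
  exact ⟨Subring.closure (Set.range e), { (inferInstance : Ring (Subring.closure (Set.range e))) with
    mul_comm := this.is_comm.comm }, (Subring.closure (Set.range e)).subtype,
    fun i => ⟨e i, Subring.subset_closure ⟨i, rfl⟩⟩, Subtype.val_injective, fun _ => rfl⟩

/-- The elements of `Fin 3` sum to zero modulo `3`. This reduces a Latin square to its upper left `2
× 2` block, small enough for a finite check. -/
theorem fin_three_third : ∀ x y z : Fin 3, x ≠ y → y ≠ z → x ≠ z → z = -(x + y) := by decide

/-- A `3 × 3` Latin square. -/
def IsLatin (g : Fin 3 → Fin 3 → Fin 3) : Prop :=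
  ∀ i j i' j', RookAdj i j i' j' → g i j ≠ g i' j'

theorem IsLatin.entries {g : Fin 3 → Fin 3 → Fin 3} (h : IsLatin g) :
    (g 0 2 = -(g 0 0 + g 0 1) ∧ g 1 2 = -(g 1 0 + g 1 1) ∧ g 2 0 = -(g 0 0 + g 1 0) ∧
      g 2 1 = -(g 0 1 + g 1 1) ∧ g 2 2 = -(g 0 2 + g 1 2)) ∧
      g 0 0 ≠ g 0 1 ∧ g 1 0 ≠ g 1 1 ∧ g 0 0 ≠ g 1 0 ∧ g 0 1 ≠ g 1 1 ∧ g 0 2 ≠ g 1 2 ∧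
      g 2 0 ≠ g 2 1 := by
  have hr : ∀ i j j', j ≠ j' → g i j ≠ g i j' := fun i j j' hj => h _ _ _ _ (Or.inl ⟨rfl, hj⟩)
  have hc : ∀ j i i', i ≠ i' → g i j ≠ g i' j := fun j i i' hi => h _ _ _ _ (Or.inr ⟨hi, rfl⟩)
  refine ⟨⟨?_, ?_, ?_, ?_, ?_⟩, ?_, ?_, ?_, ?_, ?_, ?_⟩
  · exact fin_three_third _ _ _ (hr 0 0 1 (by decide)) (hr 0 1 2 (by decide)) (hr 0 0 2 (by decide))
  · exact fin_three_third _ _ _ (hr 1 0 1 (by decide)) (hr 1 1 2 (by decide)) (hr 1 0 2 (by decide))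
  · exact fin_three_third _ _ _ (hc 0 0 1 (by decide)) (hc 0 1 2 (by decide)) (hc 0 0 2 (by decide))
  · exact fin_three_third _ _ _ (hc 1 0 1 (by decide)) (hc 1 1 2 (by decide)) (hc 1 0 2 (by decide))
  · exact fin_three_third _ _ _ (hc 2 0 1 (by decide)) (hc 2 1 2 (by decide)) (hc 2 0 2 (by decide))
  · exact hr 0 0 1 (by decide)
  · exact hr 1 0 1 (by decide)
  · exact hc 0 0 1 (by decide)
  · exact hc 1 0 1 (by decide)
  · exact hc 2 0 1 (by decide)
  · exact hr 2 0 1 (by decide)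

/-- The central entry of a Latin square in terms of the first row and of the last entry. -/
theorem IsLatin.center {g : Fin 3 → Fin 3 → Fin 3} (h : IsLatin g) :
    g 1 1 = if g 0 0 = g 2 2 then g 0 0 else g 0 2 := by
  obtain ⟨⟨h1, h2, h3, h4, h5⟩, h'⟩ := h.entries
  rw [h3, h4, h2, h1] at h'
  rw [h5, h2, h1]
  generalize g 0 0 = a at *
  generalize g 0 1 = b at *
  generalize g 1 0 = c at *
  generalize g 1 1 = d at *
  clear h1 h2 h3 h4 h5 h
  revert a b c d
  decide

theorem IsLatin.diagonal {g : Fin 3 → Fin 3 → Fin 3} (h : IsLatin g) (h1 : g 0 0 = g 1 1) :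
    g 2 2 = g 0 0 := by
  have := h.center
  by_contra hne
  rw [if_neg (Ne.symm hne), ← h1] at this
  exact h 0 0 0 2 (Or.inl ⟨rfl, by decide⟩) this

/-- The colorings of the first gadget. -/
theorem IsLatin.gadget {g : Fin 3 → Fin 3 → Fin 3} (h : IsLatin g) {A C : Fin 3} (hAC : A ≠ C)
    (hAB : A ≠ g 0 1) (hBC : g 0 1 ≠ C) (hA : A ≠ g 2 2) (hC : C ≠ g 1 0) :
    (A = g 0 0 ∧ A ≠ g 1 0 ∧ A ≠ g 1 1 ∧ A = g 2 1) ∨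
      (A ≠ g 0 0 ∧ A = g 1 0 ∧ A ≠ g 1 1 ∧ A = g 2 1) ∨
      (A ≠ g 0 0 ∧ A ≠ g 1 0 ∧ A = g 1 1 ∧ A ≠ g 2 1) := by
  obtain ⟨⟨h1, h2, h3, h4, h5⟩, h'⟩ := h.entries
  have hC' := fin_three_third _ _ _ hAB hBC hAC
  rw [h3, h4, h2, h1] at h'
  rw [h4]
  rw [h5, h2, h1] at hA
  rw [hC'] at hC
  generalize g 0 0 = a at *
  generalize g 0 1 = b at *
  generalize g 1 0 = c at *
  generalize g 1 1 = d at *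
  clear h1 h2 h3 h4 h5 h hC' hBC hAC
  revert a b c d A
  decide

namespace IsColoring

variable {V R : Type} [Ring R] {G : SimpleGraph V} {e : Fin 3 → V → R}

/-- An identity between commuting color observables holds if it holds for all deterministic
colorings. -/
theorem exists_assignment_ring (h : IsColoring G e) {ι : Type} [Fintype ι] (v : ι → V)
    (hc : ∀ i j a b, Commute (e a (v i)) (e b (v j))) :
    ∃ (S : Type) (_ : CommRing S) (ψ : S →+* R) (e' : Fin 3 → ι → S),
      (∀ a i, ψ (e' a i) = e a (v i)) ∧
      ∀ z w : S, (∀ (k : Type) (_ : CommRing k) (φ : S →+* k) (f : ι → Fin 3),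
        (∀ i j, G.Adj (v i) (v j) → f i ≠ f j) →
        (∀ c i, φ (e' c i) = if f i = c then 1 else 0) → φ z = φ w) → z = w := by
  obtain ⟨S, _, ψ, e', hψ, he'⟩ := exists_commRing_lift (fun p : Fin 3 × ι => e p.1 (v p.2))
    (fun p q => hc p.2 q.2 p.1 q.1)
  refine ⟨S, inferInstance, ψ, fun a i => e' (a, i), fun a i => he' (a, i), fun z w hzw => ?_⟩
  refine eq_of_forall_assignment (fun a i => e' (a, i)) (fun a i => hψ ?_) (fun a b i hab => hψ ?_)
    (fun i => hψ ?_) fun k _ φ f hk hφ => hzw k _ φ f (fun i j hij hf => ?_) hφ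
  · rw [map_mul, he', h.idem]
  · rw [map_mul, he', he', h.orth _ hab, map_zero]
  · rw [map_sum, map_one, ← h.sum_eq_one (v i)]
    exact Finset.sum_congr rfl fun a _ => he' (a, i)
  · have h0 : e' (f i, i) * e' (f i, j) = 0 := hψ (by rw [map_mul, he', he', h.adj _ hij, map_zero])
    have h1 := congrArg φ h0
    rw [map_mul, map_zero, hφ, hφ, if_pos rfl, if_pos hf.symm, one_mul] at h1
    exact one_ne_zero h1

variable [Algebra ℂ R]

/-- The defects `1 - e c x - e c y - e c z` are idempotent, because adjacent vertices are orthogonal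
in each color, and over the three colors they sum to `3 - 3 = 0`. Three idempotents with sum zero
vanish. -/
theorem triangle_sum (h : IsColoring G e) {x y z : V} (hxy : G.Adj x y) (hyz : G.Adj y z)
    (hxz : G.Adj x z) (c : Fin 3) : e c x + e c y + e c z = 1 := by
  have hi : ∀ c, (1 - e c x - e c y - e c z) * (1 - e c x - e c y - e c z)
      = 1 - e c x - e c y - e c z := fun c => by
    simp only [mul_sub, sub_mul, mul_one, one_mul, h.idem, h.adj c hxy, h.adj c hyz, h.adj c hxz,
      h.adj c hxy.symm, h.adj c hyz.symm, h.adj c hxz.symm]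
    abel
  have hs : ∑ c, (1 - e c x - e c y - e c z) = 0 := by
    simp only [Finset.sum_sub_distrib, h.sum_eq_one]
    simp only [Finset.sum_const, Finset.card_univ, Fintype.card_fin]
    abel
  have key : 1 - e c x - e c y - e c z = 0 := by
    have hc : ∀ c : Fin 3, ∃ a b : Fin 3, c ≠ a ∧ b ≠ c ∧ b ≠ a := by decide
    obtain ⟨a, b, h1, h2, h3⟩ := hc c
    rw [sum_fin_three_of_ne _ h1 h2 h3] at hs
    exact eq_zero_of_add_add_eq_zero (hi c) (hi a) (hi b) hs
  have : e c x + e c y + e c z = 1 - (1 - e c x - e c y - e c z) := by abel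
  rw [this, key, sub_zero]

variable {w : Fin 3 → Fin 3 → V} (hw : ∀ i j i' j', RookAdj i j i' j' → G.Adj (w i j) (w i' j'))

include hw in
theorem rook_row (h : IsColoring G e) (c i : Fin 3) : ∑ j, e c (w i j) = 1 := by
  rw [Fin.sum_univ_three]
  exact h.triangle_sum (hw _ _ _ _ (Or.inl ⟨rfl, by decide⟩)) (hw _ _ _ _ (Or.inl ⟨rfl, by decide⟩))
    (hw _ _ _ _ (Or.inl ⟨rfl, by decide⟩)) c

include hw in
theorem rook_col (h : IsColoring G e) (c j : Fin 3) : ∑ i, e c (w i j) = 1 := by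
  rw [Fin.sum_univ_three]
  exact h.triangle_sum (hw _ _ _ _ (Or.inr ⟨by decide, rfl⟩)) (hw _ _ _ _ (Or.inr ⟨by decide, rfl⟩))
    (hw _ _ _ _ (Or.inr ⟨by decide, rfl⟩)) c

include hw in
-- Rows and columns of a rook's graph are triangles, so the color observables form a Latin cube.
theorem rook_commute (h : IsColoring G e) (a b i j k l : Fin 3) :
    Commute (e a (w i j)) (e b (w k l)) :=
  latin_commute (E := fun c i j => e c (w i j)) (fun c _ _ => h.idem c _)
    (fun _ _ => h.sum_eq_one _) (fun c j => h.rook_col hw c j) (fun c i => h.rook_row hw c i)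
    a i j b k l

/-- In a prism everything commutes. -/
theorem prism_commute (h : IsColoring G e) {u v : Fin 3 → V}
    (hu : ∀ i j, i ≠ j → G.Adj (u i) (u j)) (hv : ∀ i j, i ≠ j → G.Adj (v i) (v j))
    (huv : ∀ i, G.Adj (u i) (v i)) (a b i j : Fin 3) : Commute (e a (u i)) (e b (v j)) := by
  have ht : ∀ {u : Fin 3 → V}, (∀ i j, i ≠ j → G.Adj (u i) (u j)) → ∀ c, ∑ j, e c (u j) = 1 := by
    intro u hu c
    rw [Fin.sum_univ_three]
    exact h.triangle_sum (hu _ _ (by decide)) (hu _ _ (by decide)) (hu _ _ (by decide)) c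
  -- The two triangles are the first two rows of a Latin cube; their complement in each color
  -- supplies the third.
  refine latin_commute (E := fun c i j => (![e c (u j), e c (v j), 1 - e c (u j) - e c (v j)] :
    Fin 3 → R) i) ?_ ?_ ?_ ?_ a 0 i b 1 j
  · intro c i j
    fin_cases i
    · exact h.idem c _
    · exact h.idem c _
    · simp [mul_sub, sub_mul, h.idem, h.adj c (huv j), h.adj c (huv j).symm]
  · intro i j
    fin_cases i
    · exact h.sum_eq_one _
    · exact h.sum_eq_one _
    · change ∑ c, (1 - e c (u j) - e c (v j)) = 1
      simp only [Finset.sum_sub_distrib, h.sum_eq_one]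
      simp only [Finset.sum_const, Finset.card_univ, Fintype.card_fin]
      abel
  · intro c j
    simp [Fin.sum_univ_three]
  · intro c i
    fin_cases i
    · exact ht hu c
    · exact ht hv c
    · change ∑ j, (1 - e c (u j) - e c (v j)) = 1
      simp only [Finset.sum_sub_distrib, ht hu, ht hv]
      simp only [Finset.sum_const, Finset.card_univ, Fintype.card_fin]
      abel

include hw in
-- Two entries of a row or column determine the third as a complement, and the whole square is
-- reached from these four positions.
theorem commute_rook_of_corners (h : IsColoring G e) {x : R} (h00 : ∀ c, Commute x (e c (w 0 0)))
    (h01 : ∀ c, Commute x (e c (w 0 1))) (h11 : ∀ c, Commute x (e c (w 1 1)))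
    (h22 : ∀ c, Commute x (e c (w 2 2))) (c i j : Fin 3) : Commute x (e c (w i j)) := by
  have key : ∀ {p q r : R}, p + q + r = 1 → Commute x p → Commute x q → Commute x r := by
    intro p q r hs hp hq
    rw [← sub_eq_of_eq_add' hs.symm]
    exact (Commute.one_right x).sub_right (hp.add_right hq)
  have row : ∀ c i, e c (w i 0) + e c (w i 1) + e c (w i 2) = 1 := fun c i => by
    rw [← h.rook_row hw c i, Fin.sum_univ_three]
  have col : ∀ c j, e c (w 0 j) + e c (w 1 j) + e c (w 2 j) = 1 := fun c j => by
    rw [← h.rook_col hw c j, Fin.sum_univ_three]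
  have h02 := fun c => key (row c 0) (h00 c) (h01 c)
  have h12 : ∀ c, Commute x (e c (w 1 2)) := fun c =>
    key (by rw [add_right_comm]; exact col c 2) (h02 c) (h22 c)
  have h10 : ∀ c, Commute x (e c (w 1 0)) := fun c =>
    key (by rw [add_comm, ← add_assoc]; exact row c 1) (h11 c) (h12 c)
  have h20 := fun c => key (col c 0) (h00 c) (h10 c)
  have h21 := fun c => key (col c 1) (h01 c) (h11 c)
  fin_cases i <;> fin_cases j
  exacts [h00 c, h01 c, h02 c, h10 c, h11 c, h12 c, h20 c, h21 c, h22 c]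

include hw in
theorem commute_center (h : IsColoring G e) {x : R} (h0 : ∀ c j, Commute x (e c (w 0 j)))
    (h22 : ∀ c, Commute x (e c (w 2 2))) (c : Fin 3) : Commute x (e c (w 1 1)) := by
  obtain ⟨S, _, ψ, e', he', hS⟩ := h.exists_assignment_ring (fun p : Fin 3 × Fin 3 => w p.1 p.2)
    (fun p q a b => h.rook_commute hw a b _ _ _ _)
  -- The operator form of `IsLatin.center`: the sum is the observable that the entries at `(0, 0)`
  -- and `(2, 2)` agree. The center is thus a polynomial in elements that commute with `x`.
  have key : e' c (1, 1) = e' c (0, 0) * (∑ d, e' d (0, 0) * e' d (2, 2))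
      + e' c (0, 2) * (1 - ∑ d, e' d (0, 0) * e' d (2, 2)) := by
    refine hS _ _ fun k _ φ f hf hφ => ?_
    have hl : IsLatin fun i j => f (i, j) := fun i j i' j' hr => hf (i, j) (i', j') (hw _ _ _ _ hr)
    have hcen := hl.center
    simp only [map_add, map_mul, map_sub, map_one, map_sum, hφ, mul_ite, mul_one, mul_zero,
      Finset.sum_ite_eq, Finset.mem_univ, if_true]
    rw [hcen]
    by_cases hd : f (0, 0) = f (2, 2) <;> simp [hd]
  have := congrArg ψ key
  simp only [map_add, map_mul, map_sub, map_one, map_sum, he'] at this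
  rw [this]
  have hD : Commute x (∑ d, e d (w 0 0) * e d (w 2 2)) :=
    Commute.sum_right _ _ _ fun d _ => (h0 d 0).mul_right (h22 d)
  exact ((h0 c 0).mul_right hD).add_right ((h0 c 2).mul_right ((Commute.one_right x).sub_right hD))

end IsColoring

/-- The observable "`A` and `v` have the same color". -/
def agree {V R : Type} [Ring R] (e : Fin 3 → V → R) (A v : V) : R := ∑ c, e c A * e c v

namespace IsColoring

variable {V R : Type} [Ring R] {G : SimpleGraph V} {e : Fin 3 → V → R}

theorem agree_idem (h : IsColoring G e) {A v : V} (hc : ∀ a b, Commute (e a A) (e b v)) :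
    agree e A v * agree e A v = agree e A v := by
  unfold agree
  rw [Finset.sum_mul_sum]
  refine Finset.sum_congr rfl fun c _ => ?_
  rw [Finset.sum_eq_single c]
  · rw [mul_assoc, ← mul_assoc (e c v), ← (hc c c).eq, mul_assoc (e c A), ← mul_assoc (e c A),
      h.idem, h.idem]
  · intro d _ hd
    rw [mul_assoc, ← mul_assoc (e c v), ← (hc d c).eq, mul_assoc, ← mul_assoc, h.orth A hd.symm,
      zero_mul]
  · simp

theorem star_agree [StarRing R] (hsa : ∀ a x, star (e a x) = e a x) {A v : V}
    (hc : ∀ a b, Commute (e a A) (e b v)) : star (agree e A v) = agree e A v := by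
  unfold agree
  rw [star_sum]
  refine Finset.sum_congr rfl fun c _ => ?_
  rw [star_mul, hsa, hsa, (hc c c).eq]

variable [Algebra ℂ R] {w : Fin 3 → Fin 3 → V} (hw : ∀ i j i' j', RookAdj i j i' j' → G.Adj (w i j) (w i' j'))

include hw in
/-- The linking gadget: `A` cannot agree with two diagonal vertices. -/
theorem agree_mul_agree (h : IsColoring G e) {A : V} (hA : G.Adj A (w 2 2))
    (hc : ∀ a b i j, Commute (e a A) (e b (w i j))) :
    agree e A (w 0 0) * agree e A (w 1 1) = 0 ∧ agree e A (w 1 1) * agree e A (w 0 0) = 0 := by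
  obtain ⟨S, _, ψ, e', he', hS⟩ := h.exists_assignment_ring
    (fun o : Option (Fin 3 × Fin 3) => o.elim A fun p => w p.1 p.2) (by
      rintro (_ | p) (_ | q) a b
      · by_cases hab : a = b
        · subst hab; rfl
        · change Commute (e a A) (e b A)
          rw [Commute, SemiconjBy, h.orth A hab, h.orth A (Ne.symm hab)]
      · exact hc a b _ _
      · exact (hc b a _ _).symm
      · exact h.rook_commute hw a b _ _ _ _)
  have key : (∑ c, e' c none * e' c (some (0, 0))) * (∑ c, e' c none * e' c (some (1, 1))) = 0 := by
    refine hS _ _ fun k _ φ f hf hφ => ?_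
    have hl : IsLatin fun i j => f (some (i, j)) := fun i j i' j' hr =>
      hf (some (i, j)) (some (i', j')) (hw _ _ _ _ hr)
    have hA' : f none ≠ f (some (2, 2)) := hf none (some (2, 2)) hA
    simp only [map_mul, map_sum, map_zero, hφ, mul_ite, mul_one, mul_zero, Finset.sum_ite_eq,
      Finset.mem_univ, if_true]
    split_ifs with h1 h2
    -- If `A` shared the color of both diagonal vertices, the third diagonal vertex would have it
    -- too, though it is adjacent to `A`.
    · exact absurd ((hl.diagonal (h2.symm.trans h1)).trans h2.symm) hA'.symm
    all_goals rfl
  have key' := key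
  rw [mul_comm] at key'
  have h1 := congrArg ψ key
  have h2 := congrArg ψ key'
  simp only [map_mul, map_sum, map_zero, he'] at h1 h2
  exact ⟨h1, h2⟩

include hw in
/-- The choice gadget. -/
theorem agree_gadget (h : IsColoring G e) {A C : V} (hAC : G.Adj A C) (hAB : G.Adj A (w 0 1))
    (hBC : G.Adj (w 0 1) C) (hA : G.Adj A (w 2 2)) (hC : G.Adj C (w 1 0))
    (hc : ∀ a b i j, Commute (e a A) (e b (w i j))) :
    agree e A (w 0 0) + agree e A (w 1 0) + agree e A (w 1 1) = 1 ∧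
      agree e A (w 2 1) = agree e A (w 0 0) + agree e A (w 1 0) := by
  have same : ∀ v a b, Commute (e a v) (e b v) := fun v a b => by
    by_cases hab : a = b
    · subst hab; rfl
    · rw [Commute, SemiconjBy, h.orth v hab, h.orth v (Ne.symm hab)]
  -- In the triangle `A`, `w 0 1`, `C` the observables of `C` are complements of those of the other
  -- two vertices.
  have hCw : ∀ a b i j, Commute (e a C) (e b (w i j)) := fun a b i j => by
    rw [← sub_eq_of_eq_add' (h.triangle_sum hAB hBC hAC a).symm]
    exact (Commute.one_left _).sub_left ((hc a b i j).add_left (h.rook_commute hw a b _ _ _ _))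
  obtain ⟨S, _, ψ, e', he', hS⟩ := h.exists_assignment_ring
    (fun o : Bool ⊕ Fin 3 × Fin 3 => o.elim (fun b => bif b then A else C) fun p => w p.1 p.2) (by
      rintro ((_ | _) | p) ((_ | _) | q) a b
      · exact same C a b
      · exact h.commute_of_adj hAC.symm a b
      · exact hCw a b _ _
      · exact h.commute_of_adj hAC a b
      · exact same A a b
      · exact hc a b _ _
      · exact (hCw b a _ _).symm
      · exact (hc b a _ _).symm
      · exact h.rook_commute hw a b _ _ _ _)
  have key : ∀ (k : Type) (_ : CommRing k) (φ : S →+* k) (f : Bool ⊕ Fin 3 × Fin 3 → Fin 3),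
      (∀ i j, G.Adj ((fun o : Bool ⊕ Fin 3 × Fin 3 =>
        o.elim (fun b => bif b then A else C) fun p => w p.1 p.2) i)
        ((fun o : Bool ⊕ Fin 3 × Fin 3 =>
        o.elim (fun b => bif b then A else C) fun p => w p.1 p.2) j) → f i ≠ f j) → _ :=
    fun k _ φ f hf => IsLatin.gadget (g := fun i j => f (.inr (i, j)))
      (fun i j i' j' hr => hf (.inr (i, j)) (.inr (i', j')) (hw _ _ _ _ hr))
      (hf (.inl true) (.inl false) hAC) (hf (.inl true) (.inr (0, 1)) hAB)
      (hf (.inr (0, 1)) (.inl false) hBC) (hf (.inl true) (.inr (2, 2)) hA)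
      (hf (.inl false) (.inr (1, 0)) hC)
  have key1 : (∑ c, e' c (.inl true) * e' c (.inr (0, 0)))
      + (∑ c, e' c (.inl true) * e' c (.inr (1, 0)))
      + (∑ c, e' c (.inl true) * e' c (.inr (1, 1))) = 1 := by
    refine hS _ _ fun k _ φ f hf hφ => ?_
    simp only [map_add, map_mul, map_sum, map_one, hφ, mul_ite, mul_one, mul_zero,
      Finset.sum_ite_eq, Finset.mem_univ, if_true]
    rcases key k _ φ f hf with ⟨h1, h2, h3, h4⟩ | ⟨h1, h2, h3, h4⟩ | ⟨h1, h2, h3, h4⟩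
    · rw [if_pos h1, if_neg h2, if_neg h3, add_zero, add_zero]
    · rw [if_neg h1, if_pos h2, if_neg h3, add_zero, zero_add]
    · rw [if_neg h1, if_neg h2, if_pos h3, zero_add, zero_add]
  have key2 : (∑ c, e' c (.inl true) * e' c (.inr (2, 1)))
      = (∑ c, e' c (.inl true) * e' c (.inr (0, 0)))
      + (∑ c, e' c (.inl true) * e' c (.inr (1, 0))) := by
    refine hS _ _ fun k _ φ f hf hφ => ?_
    simp only [map_add, map_mul, map_sum, hφ, mul_ite, mul_one, mul_zero,
      Finset.sum_ite_eq, Finset.mem_univ, if_true]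
    rcases key k _ φ f hf with ⟨h1, h2, h3, h4⟩ | ⟨h1, h2, h3, h4⟩ | ⟨h1, h2, h3, h4⟩
    · rw [if_pos h1, if_neg h2, if_pos h4, add_zero]
    · rw [if_neg h1, if_pos h2, if_pos h4, zero_add]
    · rw [if_neg h1, if_neg h2, if_neg h4, zero_add]
  have h1 := congrArg ψ key1
  have h2 := congrArg ψ key2
  simp only [map_add, map_mul, map_sum, map_one, he'] at h1 h2
  exact ⟨h1, h2⟩

end IsColoring

/-! ## No three-coloring in a hereditary `*`-algebra -/

/-- The graph of the game `exclusiveGame`. -/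
abbrev exclusiveGraph : SimpleGraph (ReductionVertex (n := 5) (m := 1) exclusiveGame) :=
  reductionGraph (n := 5) (m := 1) exclusiveGame

/-- The class of a vertex. -/
abbrev toVertex (u : RawVertex (n := 5) (m := 1) exclusiveGame) :
    ReductionVertex (n := 5) (m := 1) exclusiveGame := Quot.mk _ u

/-- The identifications might turn an edge into a loop, which `SimpleGraph.fromRel` would discard.
The coloring built from `P` respects the identifications and excludes this: equal endpoints would
have idempotents of square zero with sum `1`. -/
theorem adj_of_edge_of_measurements {R : Type} [Ring R] [Nontrivial R] {P : Fin 4 → Fin 5 → R}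
    (hi : ∀ a x, P a x * P a x = P a x) (hs : ∀ x, ∑ a, P a x = 1)
    (ho : ∀ a b x, a ≠ b → P a x * P b x = 0) (he : ∀ a x y, x ≠ y → P a x * P a y = 0)
    {u w : RawVertex (n := 5) (m := 1) exclusiveGame}
    (h : RawVertex.Edge exclusiveGame u w) : exclusiveGraph.Adj (toVertex u) (toVertex w) := by
  refine (SimpleGraph.fromRel_adj _ _ _).2 ⟨fun heq => ?_, Or.inl ⟨u, w, rfl, rfl, h⟩⟩
  have huw : rawColor P u = rawColor P w :=
    congrArg (Quot.lift (rawColor P) fun _ _ h => rawColor_ident hs h) heq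
  obtain ⟨h1, h2, -⟩ := rawColor_measurement hi hs ho he u
  have h0 : ∀ c, rawColor P u c = 0 := fun c => by
    rw [← h1 c]
    have := (rawColor_edge hi hs ho he h c).1
    rwa [← congrFun huw c] at this
  simp only [h0, Finset.sum_const_zero] at h2
  exact zero_ne_one h2

theorem adj_of_edge {u w : RawVertex (n := 5) (m := 1) exclusiveGame}
    (h : RawVertex.Edge exclusiveGame u w) : exclusiveGraph.Adj (toVertex u) (toVertex w) := by
  obtain ⟨R, _, _, _, P, hi, hs, ho, he⟩ := exists_exclusive_measurements (Fin 5)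
  exact adj_of_edge_of_measurements hi hs ho he h

theorem adj_triangle {V : Type} {G : SimpleGraph V} {x y z : V} (hxy : G.Adj x y)
    (hyz : G.Adj y z) (hxz : G.Adj x z) (i j : Fin 3) (hij : i ≠ j) :
    G.Adj ((![x, y, z] : Fin 3 → V) i) ((![x, y, z] : Fin 3 → V) j) := by
  fin_cases i <;> fin_cases j <;> first
    | exact absurd rfl hij
    | assumption
    | (apply SimpleGraph.Adj.symm; assumption)

/-! ### Decoding a strategy from a coloring of the graph -/

section

variable {R : Type} [Ring R] [Algebra ℂ R]
  {e : Fin 3 → ReductionVertex (n := 5) (m := 1) exclusiveGame → R}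

theorem rookV_adj (α : Fin 2) (x : Fin 5) (i j i' j' : Fin 3) (h : RookAdj i j i' j') :
    exclusiveGraph.Adj (toVertex (.v i j α x)) (toVertex (.v i' j' α x)) :=
  adj_of_edge (.rookV i j i' j' α x h)

theorem toVertex_v01 (α : Fin 2) (x : Fin 5) : toVertex (.v 0 1 α x) = toVertex .B :=
  Quot.sound (.v12 α x)

/-- This is the purpose of the vertices `t`: with `A` they form a triangle joined as a prism to the
first row, whose middle vertex is `B`. So `A` commutes with that row, and with the adjacent corner
`v 2 2`; `commute_center` and completion of rows and columns give the rest. -/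
theorem IsColoring.commute_A_v (h : IsColoring exclusiveGraph e) (a b i j : Fin 3) (α : Fin 2)
    (x : Fin 5) : Commute (e a (toVertex .A)) (e b (toVertex (.v i j α x))) := by
  have hw := rookV_adj α x
  have hB := toVertex_v01 α x
  have hprism := h.prism_commute
    (u := ![toVertex .A, toVertex (.t 0 α x), toVertex (.t 1 α x)])
    (v := ![toVertex (.v 0 1 α x), toVertex (.v 0 0 α x), toVertex (.v 0 2 α x)])
    (adj_triangle (adj_of_edge (.prismA 0 α x)) (adj_of_edge (.prismT α x))
      (adj_of_edge (.prismA 1 α x)))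
    (adj_triangle (hw _ _ _ _ (Or.inl ⟨rfl, by decide⟩)) (hw _ _ _ _ (Or.inl ⟨rfl, by decide⟩))
      (hw _ _ _ _ (Or.inl ⟨rfl, by decide⟩)))
    (fun i => by
      fin_cases i
      · change exclusiveGraph.Adj (toVertex .A) (toVertex (.v 0 1 α x))
        rw [hB]
        exact adj_of_edge .AB
      · exact (adj_of_edge (.prism1 α x)).symm
      · exact (adj_of_edge (.prism2 α x)).symm)
  have h00 : ∀ c, Commute (e a (toVertex .A)) (e c (toVertex (.v 0 0 α x))) := fun c =>
    hprism a c 0 1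
  have h01 : ∀ c, Commute (e a (toVertex .A)) (e c (toVertex (.v 0 1 α x))) := fun c =>
    hprism a c 0 0
  have h02 : ∀ c, Commute (e a (toVertex .A)) (e c (toVertex (.v 0 2 α x))) := fun c =>
    hprism a c 0 2
  have h22 : ∀ c, Commute (e a (toVertex .A)) (e c (toVertex (.v 2 2 α x))) := fun c =>
    h.commute_of_adj (adj_of_edge (.Av33 α x)) a c
  have h11 := h.commute_center hw (x := e a (toVertex .A)) (fun c j => by
    fin_cases j
    exacts [h00 c, h01 c, h02 c]) h22
  exact h.commute_rook_of_corners hw h00 h01 h11 h22 b i j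

theorem toVertex_hat_eq_v (a : Fin 4) (x : Fin 5) :
    ∃ i j α, RawVertex.hat (n := 5) (m := 1) exclusiveGame a x = .v i j α x := by
  fin_cases a
  exacts [⟨0, 0, 0, rfl⟩, ⟨1, 0, 0, rfl⟩, ⟨1, 0, 1, rfl⟩, ⟨1, 1, 1, rfl⟩]

theorem IsColoring.commute_A_hat (h : IsColoring exclusiveGraph e) (a b : Fin 3) (o : Fin 4)
    (x : Fin 5) : Commute (e a (toVertex .A))
      (e b (toVertex (RawVertex.hat (n := 5) (m := 1) exclusiveGame o x))) := by
  obtain ⟨i, j, α, hv⟩ := toVertex_hat_eq_v o x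
  rw [hv]
  exact h.commute_A_v a b i j α x

/-- The observable of answer `a` to question `x` that is decoded from a coloring. -/
def decode (e : Fin 3 → ReductionVertex (n := 5) (m := 1) exclusiveGame → R) (a : Fin 4)
    (x : Fin 5) : R :=
  agree e (toVertex .A) (toVertex (RawVertex.hat (n := 5) (m := 1) exclusiveGame a x))

/-- The second choice gadget splits `1` into the answers `2` and `3` and its corner `v 0 0`; this
corner is `v 2 1` of the first gadget, where agreement with `A` is the sum for the answers `0` and
`1`. -/
theorem IsColoring.sum_decode (h : IsColoring exclusiveGraph e) (x : Fin 5) :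
    ∑ a, decode e a x = 1 := by
  have hg : ∀ α : Fin 2, _ := fun α => h.agree_gadget (A := toVertex .A) (C := toVertex .C)
    (w := fun i j => toVertex (.v i j α x)) (rookV_adj α x) (adj_of_edge .AC)
    (by simp only [toVertex_v01 α x]; exact adj_of_edge .AB)
    (by simp only [toVertex_v01 α x]; exact adj_of_edge .BC)
    (adj_of_edge (.Av33 α x)) (adj_of_edge (.Cv21 α x))
    (fun a b i j => h.commute_A_v a b i j α x)
  obtain ⟨-, h1⟩ := hg 0
  obtain ⟨h2, -⟩ := hg 1
  have hch : toVertex (.v 2 1 0 x) = toVertex (.v 0 0 1 x) := Quot.sound (.chain 0 x)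
  rw [← hch, h1] at h2
  rw [Fin.sum_univ_four]
  exact h2

/-- The linking gadget applies once `A` commutes with the whole square `q`. Two of the four required
corners are answer vertices, the other two are adjacent to `A`, one of them being `B` or `C`. -/
theorem IsColoring.decode_mul_decode (h : IsColoring exclusiveGraph e) (a : Fin 4) {x y : Fin 5}
    (hxy : x < y) : decode e a x * decode e a y = 0 ∧ decode e a y * decode e a x = 0 := by
  have hrule : ¬ exclusiveGame.rule a a x y := fun hr =>
    (hr.2 hxy).1.2 ((SimpleGraph.top_adj x y).2 hxy.ne) rfl
  have hEF : SetE (m := 1) exclusiveGame a a x y ∨ SetF (m := 1) exclusiveGame a a x y := by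
    by_cases hext : IsExtreme (m := 1) a
    · exact Or.inl ⟨hrule, hxy.ne, hext, hext⟩
    · exact Or.inr ⟨hrule, hxy.ne, hext, hext⟩
  have h11 : toVertex (.q 0 0 a a x y hEF)
    = toVertex (RawVertex.hat (n := 5) (m := 1) exclusiveGame a x) := Quot.sound (.q11 a a x y hEF)
  have h22 : toVertex (.q 1 1 a a x y hEF)
    = toVertex (RawVertex.hat (n := 5) (m := 1) exclusiveGame a y) := Quot.sound (.q22 a a x y hEF)
  have hw : ∀ i j i' j', RookAdj i j i' j' → exclusiveGraph.Adj (toVertex (.q i j a a x y hEF))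
      (toVertex (.q i' j' a a x y hEF)) := fun i j i' j' hr =>
    adj_of_edge (.rookQ i j i' j' a a x y hEF hr)
  have h33 := adj_of_edge (.Aq33 a a x y hEF)
  have h12 : ∀ c d, Commute (e c (toVertex .A)) (e d (toVertex (.q 0 1 a a x y hEF))) := by
    intro c d
    rcases hEF with hE | hF
    · have : toVertex (.q 0 1 a a x y (.inl hE)) = toVertex .B := Quot.sound (.q12E a a x y hE)
      rw [this]
      exact h.commute_of_adj (adj_of_edge .AB) c d
    · have : toVertex (.q 0 1 a a x y (.inr hF)) = toVertex .C := Quot.sound (.q12F a a x y hF)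
      rw [this]
      exact h.commute_of_adj (adj_of_edge .AC) c d
  have := h.agree_mul_agree (w := fun i j => toVertex (.q i j a a x y hEF)) hw h33
    (fun c d i j => h.commute_rook_of_corners (w := fun i j => toVertex (.q i j a a x y hEF)) hw
      (fun d => by rw [h11]; exact h.commute_A_hat c d a x) (h12 c)
      (fun d => by rw [h22]; exact h.commute_A_hat c d a y)
      (fun d => h.commute_of_adj h33 c d) d i j)
  simp only [h11, h22] at this
  exact this

/-- The graph has no `3`-coloring by projections of a hereditary `*`-algebra. -/
theorem IsColoring.false_of_isHereditary [StarRing R] [Nontrivial R] (hR : IsHereditary R)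
    (h : IsColoring exclusiveGraph e) (hsa : ∀ a v, star (e a v) = e a v) : False := by
  have hi : ∀ a x, decode e a x * decode e a x = decode e a x := fun a x =>
    h.agree_idem fun c d => h.commute_A_hat c d a x
  have hst : ∀ a x, star (decode e a x) = decode e a x := fun a x =>
    star_agree hsa fun c d => h.commute_A_hat c d a x
  have ho : ∀ a x y, x ≠ y → decode e a x * decode e a y = 0 := fun a x y hxy => by
    rcases lt_or_gt_of_ne hxy with hlt | hlt
    · exact (h.decode_mul_decode a hlt).1
    · exact (h.decode_mul_decode a hlt).2
  have hf : ∀ a, (∑ x, decode e a x) * (∑ x, decode e a x) = ∑ x, decode e a x := fun a => by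
    rw [Finset.sum_mul_sum]
    refine Finset.sum_congr rfl fun x _ => ?_
    rw [Finset.sum_eq_single x (fun y _ hy => ho a x y hy.symm) (by simp), hi]
  have hfs : ∀ a, star (∑ x, decode e a x) = ∑ x, decode e a x := fun a => by
    rw [star_sum]
    exact Finset.sum_congr rfl fun x _ => hst a x
  have htot : ∑ a, ∑ x, decode e a x = 5 := by
    rw [Finset.sum_comm]
    simp only [h.sum_decode]
    simp
  -- The complements `1 - ∑ x, decode e a x` are projections with sum `4 - 5`, so adjoining the
  -- square of `1` gives a vanishing sum of squares, and the entry `1` must be zero.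
  have key := hR 5 (Fin.cons 1 fun a : Fin 4 => 1 - ∑ x, decode e a x) (by
    rw [Fin.sum_univ_succ]
    simp only [Fin.cons_zero, Fin.cons_succ, star_one, mul_one, star_sub, hfs, mul_sub, sub_mul,
      one_mul, hf, sub_self, sub_zero, Finset.sum_sub_distrib, htot]
    simp only [Finset.sum_const, Finset.card_univ, Fintype.card_fin, nsmul_eq_mul, mul_one]
    norm_num) 0
  rw [Fin.cons_zero] at key
  exact one_ne_zero key

end

/-! ## The quotient by the null ideal of a trace -/

namespace TracialState

variable {A : Type} [Ring A] [StarRing A] [Algebra ℂ A] [StarModule ℂ A] (τ : TracialState A)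

/-- Polarization: `τ (y* y)` is real for `y = x`, `1 + x` and `1 + i x`. -/
theorem map_star (x : A) : τ.toFun (star x) = star (τ.toFun x) := by
  have h0 := τ.im_eq_zero x
  have h1 := τ.im_eq_zero (1 + x)
  have h2 := τ.im_eq_zero (1 + Complex.I • x)
  simp only [star_add, star_one, star_smul, add_mul, mul_add, one_mul, mul_one, smul_mul_assoc,
    mul_smul_comm, map_add, map_smul, τ.map_one] at h1 h2
  simp only [smul_eq_mul, Complex.add_im, Complex.mul_im, Complex.one_im, Complex.I_re,
    Complex.I_im, Complex.star_def, Complex.conj_I, Complex.neg_re, Complex.neg_im, Complex.mul_re,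
    Complex.add_re, h0] at h1 h2
  apply Complex.ext
  · simp only [Complex.star_def, Complex.conj_re]; linarith
  · simp only [Complex.star_def, Complex.conj_im]; linarith

theorem mul_eq_zero_of_star_mul_self {x : A} (hx : τ.toFun (star x * x) = 0) (z : A) :
    τ.toFun (z * x) = 0 := by
  set w := τ.toFun (z * x) with hw
  have hw' : τ.toFun (star x * star z) = star w := by rw [hw, ← map_star, star_mul]
  set c := (τ.toFun (z * star z)).re with hc
  -- The degenerate Cauchy–Schwarz argument: as `τ (x* x) = 0`, the positivity condition is affine
  -- in `t`. The value of `t` chosen below makes the right-hand side `-1` unless `w = 0`.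
  have key : ∀ t : ℝ, 0 ≤ c - 2 * t * Complex.normSq w := fun t => by
    have h := τ.re_nonneg (star z - ((t : ℂ) * star w) • x)
    simp only [star_sub, star_smul, star_star, sub_mul, mul_sub, smul_mul_assoc, mul_smul_comm,
      map_sub, map_smul, hx, hw', ← hw] at h
    simp only [smul_eq_mul, star_mul', Complex.sub_re, Complex.sub_im, Complex.mul_re, Complex.mul_im,
      Complex.star_def, Complex.conj_re, Complex.conj_im, Complex.ofReal_re, Complex.ofReal_im,
      ← hc, Complex.conj_ofReal, mul_zero, Complex.zero_re, Complex.zero_im] at h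
    rw [Complex.normSq_apply]
    linarith
  by_contra h0
  have hpos := Complex.normSq_pos.2 h0
  have h1 := key ((c + 1) / (2 * Complex.normSq w))
  have h2 : 2 * ((c + 1) / (2 * Complex.normSq w)) * Complex.normSq w = c + 1 := by
    field_simp
  linarith

/-- The congruence of the null ideal of a trace. -/
def nullCon : RingCon A where
  r x y := ∀ z, τ.toFun (z * (x - y)) = 0
  iseqv := by
    refine ⟨fun x z => by simp, fun {x y} h z => ?_, fun {x y w} h1 h2 z => ?_⟩
    · rw [← neg_sub, mul_neg, map_neg, h z, neg_zero]
    · rw [← sub_add_sub_cancel x y w, mul_add, map_add, h1, h2, add_zero]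
  add' := by
    intro x y x' y' h1 h2 z
    rw [add_sub_add_comm, mul_add, map_add, h1, h2, add_zero]
  mul' := by
    intro x y x' y' h1 h2 z
    have : z * (x * x' - y * y') = z * (x - y) * x' + z * y * (x' - y') := by noncomm_ring
    rw [this, map_add, h2, add_zero, τ.trace, ← mul_assoc, h1]

theorem nullCon_star (x y : A) (h : τ.nullCon x y) : τ.nullCon (star x) (star y) := fun z => by
  have : z * (star x - star y) = star ((x - y) * star z) := by
    rw [star_mul, star_star, star_sub]
  rw [this, map_star, τ.trace, h, star_zero]

end TracialState

/-! ## From winning strategies to hereditary colorings -/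

/-- A coloring by projections of a non-zero hereditary `*`-algebra. -/
def HasHereditaryColoring {V : Type} (G : SimpleGraph V) (c : ℕ) : Prop :=
  ∃ (B : Type) (_ : Ring B) (_ : StarRing B) (_ : Algebra ℂ B), Nontrivial B ∧ IsHereditary B ∧
    ∃ e : Fin c → V → B, IsColoring G e ∧ ∀ a v, star (e a v) = e a v

section Strategies

variable {V : Type} {G : SimpleGraph V} {c : ℕ}

theorem not_rule_of_ne {a b : Fin c} (x : V) (hab : a ≠ b) :
    ¬ (homGame G (⊤ : SimpleGraph (Fin c))).rule a b x x := fun h => hab (h.1 rfl)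

theorem not_rule_of_adj (a : Fin c) {x y : V} (hxy : G.Adj x y) :
    ¬ (homGame G (⊤ : SimpleGraph (Fin c))).rule a a x y := fun h => (h.2 hxy).ne rfl

/-- Modulo the null ideal the trace is faithful, so the quotient is hereditary. By traciality `τ
((EF)* (EF)) = τ (EF)` for projections `E`, `F`, so a probability zero becomes a zero product. No
norm is used, hence the ultrapower is covered as well. -/
theorem hasHereditaryColoring_of_trace {A : Type} [Ring A] [StarRing A] [Algebra ℂ A]
    [StarModule ℂ A] (τ : TracialState A) {p : Fin c → Fin c → V → V → ℝ}
    (hp : p ∈ tracialCorrelations V (Fin c) τ)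
    (hw : Wins (homGame G (⊤ : SimpleGraph (Fin c))) p) : HasHereditaryColoring G c := by
  obtain ⟨E, hE, hpE⟩ := hp
  let : StarRing τ.nullCon.Quotient := starRingQuotient τ.nullCon τ.nullCon_star
  have hnull : ∀ {x : A}, τ.toFun (star x * x) = 0 → (x : τ.nullCon.Quotient) = 0 := fun hx =>
    (RingCon.eq _).2 fun z => by rw [sub_zero]; exact τ.mul_eq_zero_of_star_mul_self hx z
  have hidem : ∀ a x, E a x * E a x = E a x := fun a x => (hE.proj a x).isIdempotentElem
  have hstar : ∀ a x, star (E a x) = E a x := fun a x => (hE.proj a x).isSelfAdjoint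
  have horth : ∀ a b x y, ¬ (homGame G (⊤ : SimpleGraph (Fin c))).rule a b x y →
      (E a x : τ.nullCon.Quotient) * (E b y : τ.nullCon.Quotient) = 0 := fun a b x y hr => by
    have h0 : τ.toFun (E a x * E b y) = 0 := by
      rw [← hpE, hw a b x y hr, Complex.ofReal_zero]
    refine hnull (x := E a x * E b y) ?_
    rw [star_mul, hstar, hstar, mul_assoc, ← mul_assoc (E a x), hidem, τ.trace, mul_assoc, hidem, h0]
  refine ⟨τ.nullCon.Quotient, inferInstance, inferInstance, inferInstance, ⟨⟨1, 0, fun h => ?_⟩⟩,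
    fun m x hx => ?_, fun a x => (E a x : τ.nullCon.Quotient), ⟨fun a x => ?_, fun x => ?_,
      fun x hab => horth _ _ x x (not_rule_of_ne x hab),
      fun a _ _ hxy => horth a a _ _ (not_rule_of_adj a hxy)⟩, fun a x => ?_⟩
  · have := (RingCon.eq τ.nullCon (a := 1) (b := 0)).1 h 1
    rw [sub_zero, one_mul, τ.map_one] at this
    exact one_ne_zero this
  · choose r hr using fun i => τ.nullCon.mk'_surjective (x i)
    have hx' : τ.nullCon.mk' (∑ i, star (r i) * r i) = τ.nullCon.mk' 0 := by
      rw [map_sum, map_zero, ← hx]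
      refine Finset.sum_congr rfl fun i _ => ?_
      rw [← hr i]
      rfl
    have h1 := (RingCon.eq τ.nullCon).1 hx' 1
    rw [sub_zero, one_mul, map_sum] at h1
    have h2 := congrArg Complex.re h1
    rw [Complex.re_sum, Complex.zero_re,
      Finset.sum_eq_zero_iff_of_nonneg fun i _ => τ.re_nonneg (r i)] at h2
    intro i
    rw [← hr i]
    exact hnull (Complex.ext (h2 i (Finset.mem_univ i)) (τ.im_eq_zero _))
  · exact congrArg τ.nullCon.mk' (hidem a x)
  · have := congrArg τ.nullCon.mk' (hE.sum_eq_one x)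
    rwa [map_sum, map_one] at this
  · exact congrArg τ.nullCon.mk' (hstar a x)

theorem hasHereditaryColoring_of_hom {B : Type} [Ring B] [StarRing B] [Algebra ℂ B] [Nontrivial B]
    (hB : IsHereditary B)
    (φ : GameAlgebra (homGame G (⊤ : SimpleGraph (Fin c))) →⋆ₐ[ℂ] B) :
    HasHereditaryColoring G c := by
  set S := gameRelations (homGame G (⊤ : SimpleGraph (Fin c))) with hS
  have horth : ∀ a b x y, ¬ (homGame G (⊤ : SimpleGraph (Fin c))).rule a b x y →
      φ (Presented.mk S (gen (a, x))) * φ (Presented.mk S (gen (b, y))) = 0 := fun a b x y hr => by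
    have := Presented.mk_eq_zero (S := S) (Or.inr (Or.inr ⟨a, b, x, y, hr, rfl⟩))
    rw [← map_mul, ← map_mul, this, map_zero]
  refine ⟨B, inferInstance, inferInstance, inferInstance, inferInstance, hB,
    fun a x => φ (Presented.mk S (gen (a, x))), ⟨fun a x => ?_, fun x => ?_,
      fun x hab => horth _ _ x x (not_rule_of_ne x hab),
      fun a _ _ hxy => horth a a _ _ (not_rule_of_adj a hxy)⟩, fun a x => ?_⟩
  · have := Presented.mk_eq_zero (S := S) (Or.inl ⟨a, x, rfl⟩)
    rw [map_sub, sub_eq_zero] at this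
    rw [← map_mul, ← map_mul, this]
  · have := Presented.mk_eq_zero (S := S) (Or.inr (Or.inl ⟨x, rfl⟩))
    rw [map_sub, map_sum, map_one, sub_eq_zero] at this
    rw [← map_sum, this, map_one]
  · rw [← StarHomClass.map_star, Presented.star_mk, star_gen]

/-- The terms `x* x` are positive in the spectral order, so each vanishes with the sum, and the
C*-identity gives `x = 0`. -/
theorem isHereditary_of_cstarAlgebra (B : Type) [CStarAlgebra B] : IsHereditary B := by
  let := CStarAlgebra.spectralOrder B
  let := CStarAlgebra.spectralOrderedRing B
  intro m x hx i
  rw [Finset.sum_eq_zero_iff_of_nonneg fun i _ => star_mul_self_nonneg (x i)] at hx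
  exact CStarRing.star_mul_self_eq_zero_iff (x i) |>.1 (hx i (Finset.mem_univ i))

theorem hasHereditaryColoring_of_winning {t : Model} (ht : t ≠ .alg)
    (h : HasWinningStrategy (homGame G (⊤ : SimpleGraph (Fin c))) t) :
    HasHereditaryColoring G c := by
  cases t with
  | loc =>
    obtain ⟨p, ⟨A, _, τ, hp⟩, hw⟩ := h
    exact hasHereditaryColoring_of_trace τ hp hw
  | q =>
    obtain ⟨p, ⟨A, _, _, τ, hp⟩, hw⟩ := h
    exact hasHereditaryColoring_of_trace τ hp hw
  | qa =>
    obtain ⟨p, hp, hw⟩ := h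
    exact hasHereditaryColoring_of_trace _ hp hw
  | qc =>
    obtain ⟨p, ⟨A, _, τ, hp⟩, hw⟩ := h
    exact hasHereditaryColoring_of_trace τ hp hw
  | cstar =>
    obtain ⟨B, _, _, ⟨φ⟩⟩ := h
    exact hasHereditaryColoring_of_hom (isHereditary_of_cstarAlgebra B) φ
  | hered =>
    obtain ⟨B, _, _, _, _, _, hB, ⟨φ⟩⟩ := h
    exact hasHereditaryColoring_of_hom hB φ
  | alg => exact absurd rfl ht

/-! ## Deterministic strategies -/

/-- The observables of a deterministic strategy. -/
def detStrategy (A : Type) [Ring A] (f : V → Fin c) (a : Fin c) (x : V) : A :=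
  open Classical in if f x = a then 1 else 0

theorem sum_detStrategy (A : Type) [Ring A] (f : V → Fin c) (x : V) :
    ∑ a, detStrategy A f a x = 1 := by
  simp [detStrategy]

theorem rule_of_injective {f : V → Fin c} (hf : Function.Injective f) (x y : V) :
    (homGame G (⊤ : SimpleGraph (Fin c))).rule (f x) (f y) x y :=
  ⟨fun h => by rw [h], fun h => (SimpleGraph.top_adj _ _).2 fun hxy => h.ne (hf hxy)⟩

theorem detStrategy_mul (A : Type) [Ring A] (f : V → Fin c) (a b : Fin c) (x y : V) :
    detStrategy A f a x * detStrategy A f b y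
      = open Classical in if f x = a ∧ f y = b then 1 else 0 := by
  unfold detStrategy
  split_ifs <;> simp_all

theorem exists_tracialCorrelation_wins {A : Type} [Ring A] [StarRing A] [Algebra ℂ A]
    (τ : TracialState A) {f : V → Fin c} (hf : Function.Injective f) :
    ∃ p ∈ tracialCorrelations V (Fin c) τ, Wins (homGame G (⊤ : SimpleGraph (Fin c))) p := by
  classical
  refine ⟨fun a b x y => if f x = a ∧ f y = b then 1 else 0, ⟨detStrategy A f,
    ⟨fun a x => ?_, sum_detStrategy A f⟩, fun a b x y => ?_⟩, fun a b x y hr => if_neg ?_⟩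
  · unfold detStrategy
    split_ifs
    exacts [IsStarProjection.one A, IsStarProjection.zero A]
  · rw [detStrategy_mul]
    by_cases h : f x = a ∧ f y = b
    · simp only [if_pos h, τ.map_one, Complex.ofReal_one]
    · simp only [if_neg h, map_zero, Complex.ofReal_zero]
  · rintro ⟨rfl, rfl⟩
    exact hr (rule_of_injective hf x y)

/-- The trace of the complex numbers. -/
def complexTrace : TracialState ℂ where
  toFun := LinearMap.id
  map_one := rfl
  re_nonneg x := by
    simp only [LinearMap.id_apply, Complex.star_def, ← Complex.normSq_eq_conj_mul_self,
      Complex.ofReal_re, Complex.normSq_nonneg]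
  im_eq_zero x := by
    simp only [LinearMap.id_apply, Complex.star_def, ← Complex.normSq_eq_conj_mul_self,
      Complex.ofReal_im]
  trace x y := by rw [mul_comm]

theorem nonempty_gameAlgebra_hom {f : V → Fin c} (hf : Function.Injective f) :
    Nonempty (GameAlgebra (homGame G (⊤ : SimpleGraph (Fin c))) →⋆ₐ[ℂ] ℂ) := by
  refine nonempty_presented_hom _ (fun p => detStrategy ℂ f p.1 p.2) (fun p => ?_) ?_
  · unfold detStrategy
    split_ifs <;> simp
  · rintro r (⟨a, x, rfl⟩ | ⟨x, rfl⟩ | ⟨a, b, x, y, hr, rfl⟩)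
    · simp only [map_sub, map_mul, evalHom_gen, detStrategy_mul, and_self]
      exact sub_self _
    · simp only [map_sub, map_sum, map_one, evalHom_gen, sum_detStrategy, sub_self]
    · simp only [map_mul, evalHom_gen, detStrategy_mul]
      refine if_neg ?_
      rintro ⟨rfl, rfl⟩
      exact hr (rule_of_injective hf x y)

/-- The infimum of the empty set of naturals is `0`, so a lower bound for `chromaticNumber` requires
some winning `c`. Giving all vertices different colors wins deterministically in every one of these
models. -/
theorem exists_hasWinningStrategy [Finite V] (G : SimpleGraph V) {t : Model} (ht : t ≠ .alg) :
    ∃ c, HasWinningStrategy (homGame G (⊤ : SimpleGraph (Fin c))) t := by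
  obtain ⟨c, ⟨f⟩⟩ := Finite.exists_equiv_fin V
  have hf := f.injective
  refine ⟨c, ?_⟩
  cases t with
  | loc =>
    obtain ⟨p, hp, hw⟩ := exists_tracialCorrelation_wins (G := G) complexTrace hf
    exact ⟨p, ⟨ℂ, inferInstance, complexTrace, hp⟩, hw⟩
  | q =>
    obtain ⟨p, hp, hw⟩ := exists_tracialCorrelation_wins (G := G) complexTrace hf
    exact ⟨p, ⟨ℂ, inferInstance, inferInstance, complexTrace, hp⟩, hw⟩
  | qa => exact exists_tracialCorrelation_wins _ hf
  | qc =>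
    obtain ⟨p, hp, hw⟩ := exists_tracialCorrelation_wins (G := G) complexTrace hf
    exact ⟨p, ⟨ℂ, inferInstance, complexTrace, hp⟩, hw⟩
  | cstar => exact ⟨ℂ, inferInstance, inferInstance, nonempty_gameAlgebra_hom hf⟩
  | hered =>
    exact ⟨ℂ, inferInstance, inferInstance, inferInstance, inferInstance, inferInstance,
      isHereditary_of_cstarAlgebra ℂ, nonempty_gameAlgebra_hom hf⟩
  | alg => exact absurd rfl ht

end Strategies

/-! ### The chromatic numbers of the graph -/

theorem HasHereditaryColoring.three_lt {c : ℕ} (h : HasHereditaryColoring exclusiveGraph c) :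
    3 < c := by
  obtain ⟨B, _, _, _, _, hB, e, he, hsa⟩ := h
  refine lt_of_le_of_ne
    (he.three_le (adj_of_edge .AB) (adj_of_edge .BC) (adj_of_edge .AC)) ?_
  rintro rfl
  exact he.false_of_isHereditary hB hsa

theorem three_lt_chromaticNumber {t : Model} (ht : t ≠ .alg) :
    3 < chromaticNumber t exclusiveGraph :=
  (hasHereditaryColoring_of_winning ht
    (Nat.sInf_mem (exists_hasWinningStrategy exclusiveGraph ht))).three_lt

theorem lcChromaticNumber_exclusiveGraph : lcChromaticNumber exclusiveGraph = 3 := by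
  obtain ⟨R, _, _, _, P, hi, hs, ho, he⟩ := exists_exclusive_measurements (Fin 5)
  obtain ⟨e, hcol⟩ := exists_isColoring_reductionGraph hi hs ho he
  refine le_antisymm (Nat.sInf_le hcol.nontrivial_lc) ?_
  refine le_csInf ⟨3, hcol.nontrivial_lc⟩ fun c hc => ?_
  have : Nontrivial (Presented (lcRelations exclusiveGraph c)) := hc
  exact (isColoring_lc exclusiveGraph c).three_le (adj_of_edge .AB) (adj_of_edge .BC)
    (adj_of_edge .AC)

end SyncGames

end

/-- The graph of the asymmetric form of the game `Hom(K₅, K₄)` has locally commuting chromatic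
number `3` and hereditary chromatic number at least `4`; moreover its chromatic number is greater
than its locally commuting chromatic number in every model except the algebraic one. -/
theorem mainTheorem12 :
    let 𝒢 : SyncGames.SyncGame (Fin 5) (Fin 4) :=
      (SyncGames.homGame (⊤ : SimpleGraph (Fin 5)) (⊤ : SimpleGraph (Fin 4))).asymmetric
    let G := SyncGames.reductionGraph (n := 5) (m := 1) 𝒢
    SyncGames.lcChromaticNumber G = 3 ∧
    3 < SyncGames.chromaticNumber .hered G ∧
    ∀ t : SyncGames.Model, t ≠ .alg →
      SyncGames.lcChromaticNumber G < SyncGames.chromaticNumber t G := by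
  intro 𝒢 G
  have hlc : SyncGames.lcChromaticNumber G = 3 := SyncGames.lcChromaticNumber_exclusiveGraph
  refine ⟨hlc, SyncGames.three_lt_chromaticNumber (by simp), fun t ht => ?_⟩
  rw [hlc]
  exact SyncGames.three_lt_chromaticNumber ht
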